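/- Let $n\ge 1$, $\sigma\in[0,1)\cup(1,2]$, $s\ge 0$, $1\le p\le 2\le q\le\infty$ and $M>s+n\left(\frac1p-\frac1q\right)$ (with $\frac1\infty=0$). Write $|D|=(-\Delta)^{1/2}$ and $\langle D\rangle=(1-\Delta)^{1/2}$ (Fourier multipliers with symbols $|\xi|$ and $(1+|\xi|^2)^{1/2}$), $\|f\|_{\dot H^s_q}=\||D|^s f\|_{L^q(\mathbb R^n)}$ and $\|f\|_{H^M_p}=\|\langle D\rangle^M f\|_{L^p(\mathbb R^n)}$. Consider the Cauchy problem for the thermoelastic plate equations with friction or structural damping and Fourier's law, $$u_{tt}+\Delta^2u+\Delta\theta+(-\Delta)^{\sigma}u_t=0,\qquad \theta_t-\Delta\theta-\Delta u_t=0,\qquad t>0,\ x\in\mathbb R^n,$$ $$(u,u_t,\theta)(0,x)=(u_0,u_1,\theta_0)(x),\qquad x\in\mathbb R^n,$$ where $u_0$ is a tempered distribution and $|D|^2u_0$, $u_1$, $\theta_0$ are Schwartz functions. A solution is understood in the sense of tempered distributions in $x$, with $|D|^2u,\,u_t,\,\theta\in C([0,\infty),L^2(\mathbb R^n))$. Then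 there is a constant $C>0$, depending only on $n,\sigma,s,p,q,M$, such that for all such data, the solution satisfies for all $t\ge 0$ $$\||D|^2u(t,\cdot)\|_{\dot H^s_q}+\|u_t(t,\cdot)\|_{\dot H^s_q}+\|\theta(t,\cdot)\|_{\dot H^s_q}\le C\,(1+t)^{-\mu}\left(\||D|^2u_0\|_{H^M_p}+\|u_1\|_{H^M_p}+\|\theta_0\|_{H^M_p}\right)$$ (in particular the left-hand side is finite), where $$\mu=\mu(\sigma,n,p,q,s)=\begin{cases}\dfrac{1}{4-2\sigma}\left(s+n\left(\frac1p-\frac1q\right)\right)&\text{if }\sigma\in[0,1),\\[2mm] \dfrac{1}{2}\left(s+n\left(\frac1p-\frac1q\right)\right)&\text{if }\sigma\in(1,2].\end{cases}$$ -/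

import Mathlib

open MeasureTheory
open scoped SchwartzMap FourierTransform Laplacian ENNReal

noncomputable section

/-- The number `⟨|D|^s f, φ⟩` for `f ∈ L²(ℝⁿ)`, `s ≥ 0` and a Schwartz function `φ`, where
`|D| = (-Δ)^{1/2}`. Mathlib's Fourier transform has the kernel `e^{-2πi x·ξ}`, so the symbol of
`|D|^s` is `(2π|ξ|)^s`; a tempered distribution `T` satisfies `⟨T, φ⟩ = ⟨𝓕 T, 𝓕⁻ φ⟩`. -/
def absDPairing {n : ℕ} (s : ℝ) (f : Lp ℂ 2 (volume : Measure (EuclideanSpace ℝ (Fin n))))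
    (φ : 𝓢(EuclideanSpace ℝ (Fin n), ℂ)) : ℂ :=
  ∫ ξ : EuclideanSpace ℝ (Fin n),
    (((2 * Real.pi * ‖ξ‖) ^ s : ℝ) : ℂ) * ((𝓕 f : Lp ℂ 2 volume) ξ) * ((𝓕⁻ φ : 𝓢(_, ℂ)) ξ)

/-- `g` is an `L^q` function that represents the tempered distribution `|D|^s f`. -/
def RepresentsAbsD {n : ℕ} (s : ℝ) (q : ℝ≥0∞)
    (f : Lp ℂ 2 (volume : Measure (EuclideanSpace ℝ (Fin n))))
    (g : EuclideanSpace ℝ (Fin n) → ℂ) : Prop :=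
  MemLp g q volume ∧
    ∀ φ : 𝓢(EuclideanSpace ℝ (Fin n), ℂ), ∫ x, φ x * g x = absDPairing s f φ

/-- The Riesz potential norm `‖f‖_{Ḣ^s_q} = ‖|D|^s f‖_{L^q}` of `f ∈ L²(ℝⁿ)`. It is `∞` if
`|D|^s f` is not in `L^q`; otherwise the infimum runs over the a.e. unique representative. -/
def rieszNorm {n : ℕ} (s : ℝ) (q : ℝ≥0∞)
    (f : Lp ℂ 2 (volume : Measure (EuclideanSpace ℝ (Fin n)))) : ℝ≥0∞ :=
  ⨅ (g : EuclideanSpace ℝ (Fin n) → ℂ) (_ : RepresentsAbsD s q f g), eLpNorm g q volume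

/-- The symbol `(1 + (2π|ξ|)²)^{M/2}` of `⟨D⟩^M = (1 - Δ)^{M/2}`. -/
def besselSymbol {n : ℕ} (M : ℝ) (ξ : EuclideanSpace ℝ (Fin n)) : ℂ :=
  (((1 + ‖(2 * Real.pi) • ξ‖ ^ 2) ^ (M / 2) : ℝ) : ℂ)

/-- The Bessel potential norm `‖f‖_{H^M_p} = ‖⟨D⟩^M f‖_{L^p}` of a Schwartz function. -/
def besselNorm {n : ℕ} (M : ℝ) (p : ℝ≥0∞) (f : 𝓢(EuclideanSpace ℝ (Fin n), ℂ)) : ℝ≥0∞ :=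
  eLpNorm (SchwartzMap.fourierMultiplierCLM ℂ (besselSymbol M) f) p volume

/-- The Cauchy problem for the thermoelastic plate equations with damping `(-Δ)^σ u_t`
and Fourier's law,
`u_tt + Δ²u + Δθ + (-Δ)^σ u_t = 0`, `θ_t - Δθ - Δu_t = 0`, `(u, u_t, θ)(0) = (u₀, u₁, θ₀)`,
in the sense of tempered distributions in `x`, for solutions with `|D|²u = -Δu`, `u_t` and `θ` in
`C([0,∞), L²)`. Here `v` stands for `|D|²u` and `w` for `u_t`. -/
structure IsPlateSolution {n : ℕ} (σ : ℝ)
    (u₀ : 𝓢'(EuclideanSpace ℝ (Fin n), ℂ)) (u₁ θ₀ : 𝓢(EuclideanSpace ℝ (Fin n), ℂ))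
    (u : ℝ → 𝓢'(EuclideanSpace ℝ (Fin n), ℂ))
    (v w θ : ℝ → Lp ℂ 2 (volume : Measure (EuclideanSpace ℝ (Fin n)))) : Prop where
  absD_sq : ∀ t, 0 ≤ t → -(Δ (u t)) = (v t : 𝓢'(EuclideanSpace ℝ (Fin n), ℂ))
  time_deriv : ∀ t, 0 ≤ t → ∀ φ : 𝓢(EuclideanSpace ℝ (Fin n), ℂ),
    HasDerivWithinAt (fun τ => u τ φ)
      ((w t : 𝓢'(EuclideanSpace ℝ (Fin n), ℂ)) φ) (Set.Ici 0) t
  continuousOn_v : ContinuousOn v (Set.Ici 0)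
  continuousOn_w : ContinuousOn w (Set.Ici 0)
  continuousOn_θ : ContinuousOn θ (Set.Ici 0)
  plate_eq : ∀ t, 0 < t → ∀ φ : 𝓢(EuclideanSpace ℝ (Fin n), ℂ),
    HasDerivAt (fun τ => (w τ : 𝓢'(EuclideanSpace ℝ (Fin n), ℂ)) φ)
      (-((Δ (Δ (u t))) φ + (Δ (θ t : 𝓢'(EuclideanSpace ℝ (Fin n), ℂ))) φ
          + absDPairing (2 * σ) (w t) φ)) t
  heat_eq : ∀ t, 0 < t → ∀ φ : 𝓢(EuclideanSpace ℝ (Fin n), ℂ),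
    HasDerivAt (fun τ => (θ τ : 𝓢'(EuclideanSpace ℝ (Fin n), ℂ)) φ)
      ((Δ (θ t : 𝓢'(EuclideanSpace ℝ (Fin n), ℂ))) φ
        + (Δ (w t : 𝓢'(EuclideanSpace ℝ (Fin n), ℂ))) φ) t
  init_u : u 0 = u₀
  init_w : w 0 = u₁.toLp 2 volume
  init_θ : θ 0 = θ₀.toLp 2 volume

/-- `μ(σ,n,p,q,s)`. The expression `p⁻¹.toReal` is `1/p`, with `1/∞ = 0`. -/
def decayRate (σ : ℝ) (n : ℕ) (p q : ℝ≥0∞) (s : ℝ) : ℝ :=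
  if σ < 1 then (s + n * (p⁻¹.toReal - q⁻¹.toReal)) / (4 - 2 * σ)
  else (s + n * (p⁻¹.toReal - q⁻¹.toReal)) / 2

end

/-! On the Fourier side, with r = 2π|ξ|, a = r² and d = r^(2σ), the vector z = (𝓕(|D|²u), 𝓕u_t, 𝓕θ)
solves a 3×3 linear ODE at each frequency. The energy |z|² is dissipated only through u_t (by d) and
θ (by a). Cross terms of size b = min(1, a/d) between neighbouring components spread the dissipation
to all of z, and the corrected energy decays at rate a·b/256 (`lyap_decay`). Here a·b = min(r²,
r^(4-2σ)). For r ≤ 1 it is at least r^k, with k = 4-2σ if σ < 1 and k = 2 if σ > 1. For r ≥ 1 it is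
at least 1, because σ ≤ 2. The equation holds only weakly, so the energy argument is run for
integrals over bounded sets of frequencies and then localized to almost every ξ
(`IsWeakFourierSolution.ae_bound`).

The step from L^p to L^q uses neither Hausdorff–Young nor interpolation of operators. By duality
(`eLpNorm_le_of_schwartz_pairing`) it is enough to bound ∫ r^s e^(-c·a·b·t) (1+r²)^(-M/2) |𝓕G| |𝓕⁻φ|
by ‖G‖_p ‖φ‖_q', where G = ⟨D⟩^M f and p, q' ≤ 2 (`exists_bilinear_multiplier_bound`).
Cauchy–Schwarz reduces this to weighted L² bounds for a single Fourier transform. At low frequency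
the weight is a Gaussian e^(-T r²) with T of order (1+t)^(2/k); it costs T^(-n(1/p-1/2)/2) ·
T^(-n(1/q'-1/2)/2), which together with the decay from r^s is (1+t)^(-μ). At high frequency the time
decay is exponential, and the remaining Bessel weight is admissible because M > s + n(1/p-1/q). -/

set_option linter.unusedSectionVars false

/-! ### Gaussian-weighted L² bounds for Fourier transforms of L^p functions, 1 ≤ p ≤ 2. -/

section GaussianBound

variable {V : Type*} [NormedAddCommGroup V] [InnerProductSpace ℝ V] [FiniteDimensional ℝ V]
  [MeasurableSpace V] [BorelSpace V]

theorem integral_fourier_mul_flip {f g : V → ℂ} (hf : Integrable f) (hg : Integrable g) :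
    ∫ ξ, 𝓕 f ξ * g ξ = ∫ x, f x * 𝓕 g x := by
  have := VectorFourier.integral_fourierIntegral_smul_eq_flip (L := innerₗ V) (μ := volume)
    (ν := volume) Real.continuous_fourierChar continuous_inner hf hg
  rwa [flip_innerₗ] at this

theorem integral_fourierInv_mul_flip {f g : V → ℂ} (hf : Integrable f) (hg : Integrable g) :
    ∫ ξ, 𝓕⁻ f ξ * g ξ = ∫ x, f x * 𝓕⁻ g x := by
  have h := integral_fourier_mul_flip hf hg.comp_neg
  simp only [Real.fourierInv_eq_fourier_neg]
  rw [← integral_neg_eq_self]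
  simp only [neg_neg]
  rw [h]
  congr 1; ext x
  congr 1
  rw [Real.fourier_eq, Real.fourier_eq, ← integral_neg_eq_self]
  simp

/-- The heat kernel whose Fourier transform is `exp (-τ ‖ξ‖ ^ 2)`. -/
noncomputable def gaussKernel (τ : ℝ) (x : V) : ℝ :=
  (Real.pi / τ) ^ (Module.finrank ℝ V / 2 : ℝ) * Real.exp (-(Real.pi ^ 2 / τ) * ‖x‖ ^ 2)

theorem gaussKernel_nonneg {τ : ℝ} (hτ : 0 < τ) (x : V) : 0 ≤ gaussKernel τ x := by
  unfold gaussKernel; positivity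

theorem gaussKernel_le {τ : ℝ} (hτ : 0 < τ) (x : V) :
    gaussKernel τ x ≤ (Real.pi / τ) ^ (Module.finrank ℝ V / 2 : ℝ) := by
  unfold gaussKernel
  refine mul_le_of_le_one_right (by positivity) (Real.exp_le_one_iff.2 ?_)
  rw [neg_mul]
  exact neg_nonpos.2 (by positivity)

theorem continuous_gaussKernel (τ : ℝ) : Continuous (gaussKernel τ : V → ℝ) := by
  unfold gaussKernel; fun_prop

theorem lintegral_gaussKernel {τ : ℝ} (hτ : 0 < τ) :
    ∫⁻ x : V, ENNReal.ofReal (gaussKernel τ x) = 1 := by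
  have hb : 0 < Real.pi ^ 2 / τ := by positivity
  have h := GaussianFourier.integral_rexp_neg_mul_sq_norm (V := V) hb
  have hint : Integrable (fun x : V => Real.exp (-(Real.pi ^ 2 / τ) * ‖x‖ ^ 2)) := by
    by_contra hc
    rw [integral_undef hc] at h
    have : 0 < (Real.pi / (Real.pi ^ 2 / τ)) ^ (Module.finrank ℝ V / 2 : ℝ) := by positivity
    linarith
  rw [← ofReal_integral_eq_lintegral_ofReal (f := gaussKernel τ) (hint.const_mul _)
    (Filter.Eventually.of_forall (gaussKernel_nonneg hτ))]
  unfold gaussKernel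
  rw [integral_const_mul, h, ← Real.mul_rpow (by positivity) (by positivity)]
  have : Real.pi / τ * (Real.pi / (Real.pi ^ 2 / τ)) = 1 := by
    field_simp
  rw [this]; simp

/-- The left side is the quadratic form of convolution with the heat kernel K, namely ∬ K(x-y) f(y)
conj(f(x)); absolute values are then taken inside. The conjugate of 𝓕f is the transform of x ↦
conj(f(-x)), so two uses of the multiplication formula suffice. -/
theorem lintegral_gauss_mul_fourier_sq_le (f : 𝓢(V, ℂ)) {τ : ℝ} (hτ : 0 < τ) :
    ∫⁻ ξ, ENNReal.ofReal (Real.exp (-τ * ‖ξ‖ ^ 2)) * ‖𝓕 f ξ‖ₑ ^ 2 ≤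
      ∫⁻ x, ∫⁻ y, ENNReal.ofReal (gaussKernel τ (x - y)) * ‖f x‖ₑ * ‖f y‖ₑ := by
  set e : V → ℂ := fun ξ => Complex.exp (-(τ : ℂ) * ‖ξ‖ ^ 2) with he
  have hen : ∀ ξ, ‖e ξ‖ = Real.exp (-τ * ‖ξ‖ ^ 2) := fun ξ => by
    simp [he, Complex.norm_exp, ← Complex.ofReal_pow]
  have hec : Continuous e := by fun_prop
  have hele : ∀ ξ, ‖e ξ‖ ≤ 1 := fun ξ => by
    rw [hen, Real.exp_le_one_iff, neg_mul]; exact neg_nonpos.2 (by positivity)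
  set f' : V → ℂ := fun x => starRingEnd ℂ (f (-x)) with hf'
  have hfi : Integrable f := f.integrable
  have hf'i : Integrable f' := by
    have := hfi.comp_neg
    refine this.norm.mono' ?_ ?_
    · exact (Continuous.aestronglyMeasurable (by fun_prop))
    · simp [hf']
  set G : V → ℂ := fun ξ => e ξ * 𝓕 f ξ with hG
  have hFi : Integrable (𝓕 f : 𝓢(V, ℂ)) := (𝓕 f).integrable
  have hGi : Integrable G := hFi.bdd_mul hec.aestronglyMeasurable
    (Filter.Eventually.of_forall hele)
  have hconj : ∀ ξ, 𝓕 f' ξ = starRingEnd ℂ (𝓕 f ξ) := fun ξ => by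
    rw [SchwartzMap.fourier_coe, Real.fourier_eq, Real.fourier_eq, ← integral_conj, ← integral_neg_eq_self]
    congr 1; ext x
    simp [hf', Circle.smul_def, Real.fourierChar_apply, ← Complex.exp_conj, Complex.conj_ofNat]
  have h1 : ∫⁻ ξ, ENNReal.ofReal (Real.exp (-τ * ‖ξ‖ ^ 2)) * ‖𝓕 f ξ‖ₑ ^ 2 =
      ‖∫ ξ, 𝓕 f' ξ * G ξ‖ₑ := by
    have : ∀ ξ, 𝓕 f' ξ * G ξ = ((Real.exp (-τ * ‖ξ‖ ^ 2) * ‖𝓕 f ξ‖ ^ 2 : ℝ) : ℂ) := fun ξ => by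
      rw [hconj, hG]
      simp only [he]
      rw [mul_left_comm, mul_comm (starRingEnd ℂ _), Complex.mul_conj, Complex.normSq_eq_norm_sq]
      push_cast
      rfl
    simp_rw [this]
    rw [integral_complex_ofReal, ← ofReal_norm, Complex.norm_real, Real.norm_of_nonneg (by positivity),
      ofReal_integral_eq_lintegral_ofReal]
    · congr 1; ext ξ
      rw [ENNReal.ofReal_mul (by positivity), ENNReal.ofReal_pow (by positivity), ofReal_norm]
    · have h2 : MemLp (𝓕 f : 𝓢(V, ℂ)) 2 := (𝓕 f).memLp 2
      have h3 := (memLp_two_iff_integrable_sq_norm h2.1).1 h2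
      refine h3.bdd_mul (c := 1) (by fun_prop) (Filter.Eventually.of_forall fun ξ => ?_)
      rw [← hen, norm_norm]; exact hele ξ
    · exact Filter.Eventually.of_forall fun ξ => by positivity
  have h2 : ∀ x, 𝓕 G x = ∫ y, f y * gaussKernel τ (-x - y) := fun x => by
    have hHi : Integrable (fun v : V => Complex.exp (-(τ : ℂ) * ‖v‖ ^ 2 +
        2 * Real.pi * Complex.I * (inner ℝ (-x) v : ℝ))) :=
      GaussianFourier.integrable_cexp_neg_mul_sq_norm_add (by simpa using hτ) _ _
    have := integral_fourier_mul_flip hfi hHi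
    rw [Real.fourier_eq]
    have hl : ∀ v, 𝐞 (-inner ℝ v x) • G v = 𝓕 f v * Complex.exp (-(τ : ℂ) * ‖v‖ ^ 2 +
        2 * Real.pi * Complex.I * (inner ℝ (-x) v : ℝ)) := fun v => by
      simp only [hG, he, Circle.smul_def, Real.fourierChar_apply, Complex.exp_add, smul_eq_mul,
        inner_neg_left, real_inner_comm]
      push_cast
      ring_nf
    simp_rw [hl]
    rw [SchwartzMap.fourier_coe, this]
    congr 1; ext y
    rw [fourier_gaussian_innerProductSpace' (by simpa using hτ)]
    congr 1
    unfold gaussKernel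
    push_cast
    rw [Complex.ofReal_cpow (by positivity)]
    push_cast
    congr 2
    ring
  rw [h1, integral_fourier_mul_flip hf'i hGi]
  refine (enorm_integral_le_lintegral_enorm _).trans ?_
  rw [← lintegral_neg_eq_self (μ := volume)]
  refine lintegral_mono fun x => ?_
  rw [enorm_mul, h2]
  refine (mul_le_mul_right (enorm_integral_le_lintegral_enorm _) _).trans ?_
  rw [← lintegral_const_mul _ (by
    have := continuous_gaussKernel (V := V) τ
    exact Continuous.measurable (by fun_prop))]
  refine lintegral_mono fun y => le_of_eq ?_
  simp only [hf', neg_neg]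
  rw [enorm_mul, ← ofReal_norm (gaussKernel τ (x - y) : ℂ), Complex.norm_real,
    Real.norm_of_nonneg (gaussKernel_nonneg hτ _), RCLike.enorm_conj]
  ring

end GaussianBound

/-- A level-set splitting at height l that replaces interpolation between L¹ and L². If a and b both
exceed l, the sup bound κ of the kernel is used and each factor c is at most l^(1-P) c^P. Otherwise
ab ≤ l^(2-P)(a^P + b^P), and K is kept so that its unit mass can be used after integration. -/
theorem mul_mul_le_rpow_split {K κ a b l P : ℝ} (hK : 0 ≤ K) (hκ : K ≤ κ) (ha : 0 ≤ a) (hb : 0 ≤ b)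
    (hl : 0 < l) (hP1 : 1 ≤ P) (hP2 : P ≤ 2) :
    K * a * b ≤ κ * l ^ (2 - 2 * P) * a ^ P * b ^ P + l ^ (2 - P) * K * (a ^ P + b ^ P) := by
  have hsmall : ∀ c, 0 ≤ c → c ≤ l → c ^ 2 ≤ l ^ (2 - P) * c ^ P := fun c hc hcl => by
    rcases hc.eq_or_lt with rfl | hc'
    · simp; positivity
    have : c ^ 2 = c ^ (2 - P) * c ^ P := by
      rw [← Real.rpow_add hc']; simp
    rw [this]
    gcongr
  have hbig : ∀ c, l ≤ c → c ≤ l ^ (1 - P) * c ^ P := fun c hcl => by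
    have hc' : 0 < c := hl.trans_le hcl
    calc c = c ^ (1 - P) * c ^ P := by rw [← Real.rpow_add hc']; simp
      _ ≤ _ := mul_le_mul_of_nonneg_right
        (Real.rpow_le_rpow_of_nonpos hl hcl (by linarith)) (by positivity)
  have hl1 : l * l ^ (1 - P) = l ^ (2 - P) := by
    nth_rewrite 1 [← Real.rpow_one l]
    rw [← Real.rpow_add hl]; ring_nf
  have hl2 : l ^ (1 - P) * l ^ (1 - P) = l ^ (2 - 2 * P) := by
    rw [← Real.rpow_add hl]; ring_nf
  have haP : 0 ≤ a ^ P := by positivity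
  have hbP : 0 ≤ b ^ P := by positivity
  have hq : 0 ≤ κ * l ^ (2 - 2 * P) * a ^ P * b ^ P := by
    have := hK.trans hκ
    positivity
  have hmain : ∀ c, a * b ≤ l ^ (2 - P) * c → c ≤ a ^ P + b ^ P →
      K * a * b ≤ κ * l ^ (2 - 2 * P) * a ^ P * b ^ P + l ^ (2 - P) * K * (a ^ P + b ^ P) := by
    intro c h1 h2
    have h3 : a * b ≤ l ^ (2 - P) * (a ^ P + b ^ P) :=
      h1.trans (mul_le_mul_of_nonneg_left h2 (by positivity))
    nlinarith [mul_le_mul_of_nonneg_left h3 hK]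
  rcases le_total a l with hal | hal <;> rcases le_total b l with hbl | hbl
  · rcases le_total a b with hab | hab
    · exact hmain (b ^ P) ((by nlinarith : a * b ≤ b ^ 2).trans (hsmall b hb hbl)) (by linarith)
    · exact hmain (a ^ P) ((by nlinarith : a * b ≤ a ^ 2).trans (hsmall a ha hal)) (by linarith)
  · refine hmain (b ^ P) ?_ (by linarith)
    rw [← hl1, mul_assoc]
    exact mul_le_mul hal (hbig b hbl) hb hl.le
  · refine hmain (a ^ P) ?_ (by linarith)
    rw [← hl1, mul_assoc, mul_comm a b]
    exact mul_le_mul hbl (hbig a hal) ha hl.le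
  · have h1 : a * b ≤ l ^ (2 - 2 * P) * (a ^ P * b ^ P) := by
      rw [← hl2]
      calc a * b ≤ (l ^ (1 - P) * a ^ P) * (l ^ (1 - P) * b ^ P) :=
            mul_le_mul (hbig a hal) (hbig b hbl) hb (by positivity)
        _ = _ := by ring
    have h2 : K * (a * b) ≤ κ * (l ^ (2 - 2 * P) * (a ^ P * b ^ P)) :=
      mul_le_mul hκ h1 (by positivity) (hK.trans hκ)
    have h3 : 0 ≤ l ^ (2 - P) * K * (a ^ P + b ^ P) := by positivity
    linarith

section LpBound

variable {V : Type*} [NormedAddCommGroup V] [InnerProductSpace ℝ V] [FiniteDimensional ℝ V]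
  [MeasurableSpace V] [BorelSpace V]

theorem lintegral_gaussKernel_mul_le (f : 𝓢(V, ℂ)) {τ l P : ℝ} (hτ : 0 < τ) (hl : 0 < l)
    (hP1 : 1 ≤ P) (hP2 : P ≤ 2) :
    ∫⁻ x, ∫⁻ y, ENNReal.ofReal (gaussKernel τ (x - y)) * ‖f x‖ₑ * ‖f y‖ₑ ≤
      ENNReal.ofReal ((Real.pi / τ) ^ (Module.finrank ℝ V / 2 : ℝ) * l ^ (2 - 2 * P)) *
        (∫⁻ x, ‖f x‖ₑ ^ P) ^ 2 +
      ENNReal.ofReal (l ^ (2 - P)) * (2 * ∫⁻ x, ‖f x‖ₑ ^ P) := by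
  set κ : ℝ := (Real.pi / τ) ^ (Module.finrank ℝ V / 2 : ℝ)
  have hκ : 0 ≤ κ := by positivity
  have hmeas : Measurable fun x => ‖f x‖ₑ ^ P := by
    have := f.continuous; fun_prop
  have hKm : Measurable (gaussKernel τ : V → ℝ) := (continuous_gaussKernel τ).measurable
  have hpt : ∀ x y, ENNReal.ofReal (gaussKernel τ (x - y)) * ‖f x‖ₑ * ‖f y‖ₑ ≤
      ENNReal.ofReal (κ * l ^ (2 - 2 * P)) * ‖f x‖ₑ ^ P * ‖f y‖ₑ ^ P +
      (ENNReal.ofReal (l ^ (2 - P)) * (ENNReal.ofReal (gaussKernel τ (x - y)) * ‖f x‖ₑ ^ P) +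
       ENNReal.ofReal (l ^ (2 - P)) * (ENNReal.ofReal (gaussKernel τ (x - y)) * ‖f y‖ₑ ^ P)) := by
    intro x y
    have hK := gaussKernel_nonneg hτ (x - y)
    have h := mul_mul_le_rpow_split hK (gaussKernel_le hτ (x - y)) (norm_nonneg (f x))
      (norm_nonneg (f y)) hl hP1 hP2
    have h' := ENNReal.ofReal_le_ofReal h
    have hP0 : 0 ≤ P := by linarith
    rw [ENNReal.ofReal_mul (by positivity), ENNReal.ofReal_mul hK,
      ENNReal.ofReal_add (by positivity) (by positivity), ENNReal.ofReal_mul (by positivity),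
      ENNReal.ofReal_mul (by positivity), ENNReal.ofReal_mul (p := l ^ (2 - P) * _) (by positivity),
      ENNReal.ofReal_mul (p := l ^ (2 - P)) (by positivity),
      ENNReal.ofReal_add (by positivity) (by positivity),
      ← ENNReal.ofReal_rpow_of_nonneg (norm_nonneg _) hP0,
      ← ENNReal.ofReal_rpow_of_nonneg (norm_nonneg _) hP0, ofReal_norm, ofReal_norm] at h'
    refine h'.trans (le_of_eq ?_)
    ring
  calc _ ≤ ∫⁻ x, ∫⁻ y, (ENNReal.ofReal (κ * l ^ (2 - 2 * P)) * ‖f x‖ₑ ^ P * ‖f y‖ₑ ^ P +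
      (ENNReal.ofReal (l ^ (2 - P)) * (ENNReal.ofReal (gaussKernel τ (x - y)) * ‖f x‖ₑ ^ P) +
       ENNReal.ofReal (l ^ (2 - P)) * (ENNReal.ofReal (gaussKernel τ (x - y)) * ‖f y‖ₑ ^ P))) :=
        lintegral_mono fun x => lintegral_mono fun y => hpt x y
    _ = ∫⁻ x, (ENNReal.ofReal (κ * l ^ (2 - 2 * P)) * ‖f x‖ₑ ^ P * (∫⁻ y, ‖f y‖ₑ ^ P) +
      (ENNReal.ofReal (l ^ (2 - P)) * ‖f x‖ₑ ^ P +
       ENNReal.ofReal (l ^ (2 - P)) *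
        ∫⁻ y, ENNReal.ofReal (gaussKernel τ (x - y)) * ‖f y‖ₑ ^ P)) := by
      refine lintegral_congr fun x => ?_
      rw [lintegral_add_left (by fun_prop), lintegral_const_mul _ (by fun_prop),
        lintegral_add_left (by fun_prop), lintegral_const_mul _ (by fun_prop),
        lintegral_const_mul _ (by fun_prop), lintegral_mul_const _ (by fun_prop),
        lintegral_sub_left_eq_self (fun y => ENNReal.ofReal (gaussKernel τ y)) x,
        lintegral_gaussKernel hτ, one_mul]
    _ = _ := by
      rw [lintegral_add_left (by fun_prop), lintegral_mul_const _ (by fun_prop),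
        lintegral_const_mul _ (by fun_prop), lintegral_add_left (by fun_prop),
        lintegral_const_mul _ (by fun_prop), lintegral_const_mul' _ _ ENNReal.ofReal_ne_top,
        lintegral_lintegral_swap (by fun_prop)]
      have : ∀ y, ∫⁻ x, ENNReal.ofReal (gaussKernel τ (x - y)) * ‖f y‖ₑ ^ P = ‖f y‖ₑ ^ P := by
        intro y
        rw [lintegral_mul_const _ (by fun_prop),
          lintegral_sub_right_eq_self (fun y => ENNReal.ofReal (gaussKernel τ y)) y,
          lintegral_gaussKernel hτ, one_mul]
      simp_rw [this]
      ring

theorem lintegral_gauss_mul_fourier_sq_le_eLpNorm (f : 𝓢(V, ℂ)) {τ : ℝ} (hτ : 0 < τ) {p : ℝ≥0∞}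
    (hp1 : 1 ≤ p) (hp2 : p ≤ 2) :
    ∫⁻ ξ, ENNReal.ofReal (Real.exp (-τ * ‖ξ‖ ^ 2)) * ‖𝓕 f ξ‖ₑ ^ 2 ≤
      ENNReal.ofReal (3 * (Real.pi / τ) ^ (Module.finrank ℝ V * (p⁻¹.toReal - 1 / 2))) *
        eLpNorm f p volume ^ 2 := by
  have hp_top : p ≠ ∞ := ne_top_of_le_ne_top (by simp) hp2
  have hp0 : p ≠ 0 := (zero_lt_one.trans_le hp1).ne'
  set P := p.toReal with hP
  have hP1 : 1 ≤ P := by simpa using ENNReal.toReal_mono hp_top hp1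
  have hP2 : P ≤ 2 := by simpa using ENNReal.toReal_mono (by simp) hp2
  have hP0 : 0 < P := by linarith
  have hnorm : eLpNorm f p volume = (∫⁻ x, ‖f x‖ₑ ^ P) ^ (1 / P) :=
    eLpNorm_eq_lintegral_rpow_enorm_toReal hp0 hp_top
  have hfin : ∫⁻ x, ‖f x‖ₑ ^ P ≠ ∞ := by
    have := (f.memLp p volume).2.ne
    rw [hnorm] at this
    contrapose! this
    rw [this, ENNReal.top_rpow_of_pos (by positivity)]
  rw [ENNReal.toReal_inv]
  refine (lintegral_gauss_mul_fourier_sq_le f hτ).trans ?_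
  rw [hnorm, ← ENNReal.rpow_natCast, ← ENNReal.rpow_mul]
  set N := ∫⁻ x, ‖f x‖ₑ ^ P with hN
  set κ : ℝ := (Real.pi / τ) ^ (Module.finrank ℝ V / 2 : ℝ) with hκ
  have hκ0 : 0 < κ := by positivity
  rcases eq_or_ne N 0 with h0 | h0
  · have := lintegral_gaussKernel_mul_le f hτ one_pos hP1 hP2
    rw [← hN, h0] at this
    refine this.trans ?_
    simp
  have hNr : 0 < N.toReal := ENNReal.toReal_pos h0 hfin
  set m := N.toReal with hm
  have hNm : N = ENNReal.ofReal m := (ENNReal.ofReal_toReal hfin).symm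
  -- This level balances the two terms: l^P = κm makes κ l^(2-2P) m² equal to l^(2-P) m. The
  -- constant 3 is 1 + 2.
  have hl : 0 < (κ * m) ^ (1 / P) := by positivity
  refine (lintegral_gaussKernel_mul_le f hτ hl hP1 hP2).trans ?_
  rw [← hN, ← hκ, hNm, ← ENNReal.ofReal_pow hNr.le, ← ENNReal.ofReal_mul (by positivity),
    show (2 : ℝ≥0∞) = ENNReal.ofReal 2 by simp, ← ENNReal.ofReal_mul (by positivity),
    ← ENNReal.ofReal_mul (by positivity), ← ENNReal.ofReal_add (by positivity) (by positivity),
    ENNReal.ofReal_rpow_of_pos hNr, ← ENNReal.ofReal_mul (by positivity)]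
  refine ENNReal.ofReal_le_ofReal (le_of_eq ?_)
  have e1 : (Real.pi / τ) ^ (Module.finrank ℝ V * (P⁻¹ - 1 / 2)) = κ ^ (2 / P - 1) := by
    rw [hκ, ← Real.rpow_mul (by positivity)]; congr 1; field_simp
  have e2 : κ * ((κ * m) ^ (1 / P)) ^ (2 - 2 * P) * m ^ 2 = κ ^ (2 / P - 1) * m ^ (2 / P) := by
    rw [← Real.rpow_mul (by positivity), Real.mul_rpow hκ0.le hNr.le]
    have a1 : κ ^ (2 / P - 1) = κ * κ ^ (1 / P * (2 - 2 * P)) := by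
      nth_rewrite 2 [← Real.rpow_one κ]
      rw [← Real.rpow_add hκ0]; congr 1; field_simp; ring
    have a2 : m ^ (2 / P) = m ^ (1 / P * (2 - 2 * P)) * m ^ 2 := by
      rw [← Real.rpow_natCast m 2, ← Real.rpow_add hNr]; congr 1; push_cast; field_simp; ring
    rw [a1, a2]; ring
  have e3 : ((κ * m) ^ (1 / P)) ^ (2 - P) * (2 * m) = 2 * (κ ^ (2 / P - 1) * m ^ (2 / P)) := by
    rw [← Real.rpow_mul (by positivity), Real.mul_rpow hκ0.le hNr.le]
    have a1 : κ ^ (2 / P - 1) = κ ^ (1 / P * (2 - P)) := by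
      congr 1; field_simp
    have a2 : m ^ (2 / P) = m ^ (1 / P * (2 - P)) * m := by
      nth_rewrite 3 [← Real.rpow_one m]
      rw [← Real.rpow_add hNr]; congr 1; field_simp; ring
    rw [a1, a2]; ring
  rw [e1, e2, e3, show 1 / P * ((2 : ℕ) : ℝ) = 2 / P by push_cast; ring]
  ring

end LpBound

theorem rate_nonneg {p : ℝ≥0∞} (hp1 : 1 ≤ p) (hp2 : p ≤ 2) (n : ℕ) :
    0 ≤ n * (p⁻¹.toReal - 1 / 2) := by
  have h1 : (2⁻¹ : ℝ≥0∞) ≤ p⁻¹ := ENNReal.inv_le_inv.2 hp2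
  have h2 := ENNReal.toReal_mono (by simp; exact (zero_lt_one.trans_le hp1).ne') h1
  have h3 : (1 / 2 : ℝ) ≤ p⁻¹.toReal := by simpa using h2
  exact mul_nonneg (by positivity) (by linarith)

/-! ### Bessel-weighted L² bounds by subordination to Gaussians. -/

section BesselBound

variable {V : Type*} [NormedAddCommGroup V] [InnerProductSpace ℝ V] [FiniteDimensional ℝ V]
  [MeasurableSpace V] [BorelSpace V]

theorem lintegral_exp_mul_fourier_sq_le (f : 𝓢(V, ℂ)) {τ : ℝ} (hτ : 0 < τ) {p : ℝ≥0∞}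
    (hp1 : 1 ≤ p) (hp2 : p ≤ 2) :
    ∫⁻ ξ, ENNReal.ofReal (Real.exp (-τ * (2 * Real.pi * ‖ξ‖) ^ 2)) * ‖𝓕 f ξ‖ₑ ^ 2 ≤
      ENNReal.ofReal (3 * τ ^ (-(Module.finrank ℝ V * (p⁻¹.toReal - 1 / 2)))) *
        eLpNorm f p volume ^ 2 := by
  have h := lintegral_gauss_mul_fourier_sq_le_eLpNorm f
    (by positivity : 0 < (2 * Real.pi) ^ 2 * τ) hp1 hp2
  have hα : 0 ≤ Module.finrank ℝ V * (p⁻¹.toReal - 1 / 2) := rate_nonneg hp1 hp2 _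
  set α : ℝ := Module.finrank ℝ V * (p⁻¹.toReal - 1 / 2)
  have e : ∀ ξ : V, -τ * (2 * Real.pi * ‖ξ‖) ^ 2 = -((2 * Real.pi) ^ 2 * τ) * ‖ξ‖ ^ 2 :=
    fun ξ => by ring
  simp_rw [e]
  refine h.trans ?_
  gcongr
  rw [Real.rpow_neg hτ.le, ← Real.inv_rpow hτ.le]
  refine Real.rpow_le_rpow (by positivity) ?_ hα
  rw [div_le_iff₀ (by positivity)]
  have : τ⁻¹ * ((2 * Real.pi) ^ 2 * τ) = 4 * Real.pi ^ 2 := by field_simp; ring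
  rw [this]
  nlinarith [Real.pi_gt_three]

/-- The Gamma integral writes a Bessel weight as a superposition of Gaussians, so that the Gaussian
bound can be integrated in τ. -/
theorem ofReal_one_add_rpow_neg {a y : ℝ} (ha : 0 < a) (hy : 0 ≤ y) :
    ENNReal.ofReal ((1 + y) ^ (-a)) = ENNReal.ofReal (Real.Gamma a)⁻¹ *
      ∫⁻ τ in Set.Ioi (0 : ℝ), ENNReal.ofReal (τ ^ (a - 1) * Real.exp (-τ)) *
        ENNReal.ofReal (Real.exp (-τ * y)) := by
  have h := Real.integral_rpow_mul_exp_neg_mul_Ioi ha (by linarith : 0 < 1 + y)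
  have hG := Real.Gamma_pos_of_pos ha
  have hint : Integrable (fun τ : ℝ => τ ^ (a - 1) * Real.exp (-((1 + y) * τ)))
      (volume.restrict (Set.Ioi 0)) := by
    by_contra hc
    rw [integral_undef hc] at h
    have : 0 < (1 / (1 + y)) ^ a * Real.Gamma a := by positivity
    linarith
  have hnn : 0 ≤ᵐ[volume.restrict (Set.Ioi (0 : ℝ))]
      fun τ : ℝ => τ ^ (a - 1) * Real.exp (-((1 + y) * τ)) := by
    filter_upwards [ae_restrict_mem measurableSet_Ioi] with τ hτ
    have : 0 < τ := hτ
    show 0 ≤ τ ^ (a - 1) * Real.exp (-((1 + y) * τ))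
    positivity
  have h2 := ofReal_integral_eq_lintegral_ofReal hint hnn
  rw [h] at h2
  have h3 : ∫⁻ τ in Set.Ioi (0 : ℝ), ENNReal.ofReal (τ ^ (a - 1) * Real.exp (-τ)) *
        ENNReal.ofReal (Real.exp (-τ * y)) =
      ∫⁻ τ in Set.Ioi (0 : ℝ), ENNReal.ofReal (τ ^ (a - 1) * Real.exp (-((1 + y) * τ))) := by
    refine setLIntegral_congr_fun measurableSet_Ioi fun τ hτ => ?_
    have : 0 < τ := hτ
    rw [← ENNReal.ofReal_mul (by positivity), mul_assoc, ← Real.exp_add]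
    congr 3; ring_nf
  rw [h3, ← h2, ← ENNReal.ofReal_mul (by positivity)]
  congr 1
  rw [Real.rpow_neg (by linarith), one_div, Real.inv_rpow (by linarith)]
  field_simp

/-- With α = n(1/p - 1/2), the Gaussian bound contributes τ^(-α), and ∫ τ^(a-1-α) e^(-τ) dτ
converges at 0 exactly when a > α. The strict inequality on M is spent here. -/
theorem lintegral_bessel_mul_fourier_sq_le (f : 𝓢(V, ℂ)) {p : ℝ≥0∞} (hp1 : 1 ≤ p) (hp2 : p ≤ 2)
    {a : ℝ} (ha0 : 0 < a) (ha : Module.finrank ℝ V * (p⁻¹.toReal - 1 / 2) < a) :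
    ∫⁻ ξ, ENNReal.ofReal ((1 + (2 * Real.pi * ‖ξ‖) ^ 2) ^ (-a)) * ‖𝓕 f ξ‖ₑ ^ 2 ≤
      ENNReal.ofReal ((Real.Gamma a)⁻¹ *
        (3 * Real.Gamma (a - Module.finrank ℝ V * (p⁻¹.toReal - 1 / 2)))) *
        eLpNorm f p volume ^ 2 := by
  set α : ℝ := Module.finrank ℝ V * (p⁻¹.toReal - 1 / 2) with hα
  have hfm : Measurable (𝓕 f : 𝓢(V, ℂ)) := (𝓕 f).continuous.measurable
  have hG := Real.Gamma_pos_of_pos ha0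
  have hm : Measurable fun τ : ℝ => ENNReal.ofReal (τ ^ (a - 1) * Real.exp (-τ)) := by fun_prop
  calc _ = ∫⁻ ξ, ENNReal.ofReal (Real.Gamma a)⁻¹ * ∫⁻ τ in Set.Ioi (0 : ℝ),
        ENNReal.ofReal (τ ^ (a - 1) * Real.exp (-τ)) *
        (ENNReal.ofReal (Real.exp (-τ * (2 * Real.pi * ‖ξ‖) ^ 2)) * ‖𝓕 f ξ‖ₑ ^ 2) := by
        refine lintegral_congr fun ξ => ?_
        rw [ofReal_one_add_rpow_neg ha0 (by positivity), mul_assoc,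
          ← lintegral_mul_const _ (by fun_prop)]
        simp_rw [mul_assoc]
    _ = ENNReal.ofReal (Real.Gamma a)⁻¹ * ∫⁻ τ in Set.Ioi (0 : ℝ),
        ENNReal.ofReal (τ ^ (a - 1) * Real.exp (-τ)) *
        ∫⁻ ξ, (ENNReal.ofReal (Real.exp (-τ * (2 * Real.pi * ‖ξ‖) ^ 2)) * ‖𝓕 f ξ‖ₑ ^ 2) := by
        rw [lintegral_const_mul' _ _ ENNReal.ofReal_ne_top, lintegral_lintegral_swap (by fun_prop)]
        congr 1
        refine lintegral_congr fun τ => ?_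
        rw [lintegral_const_mul _ (by fun_prop)]
    _ ≤ ENNReal.ofReal (Real.Gamma a)⁻¹ * ∫⁻ τ in Set.Ioi (0 : ℝ),
        ENNReal.ofReal (3 * (τ ^ ((a - α) - 1) * Real.exp (-(1 * τ)))) *
          eLpNorm f p volume ^ 2 := by
        gcongr 1
        refine setLIntegral_mono (by fun_prop) fun τ hτ => ?_
        have hτ' : 0 < τ := hτ
        refine (mul_le_mul_right (lintegral_exp_mul_fourier_sq_le f hτ' hp1 hp2) _).trans
          (le_of_eq ?_)
        rw [← mul_assoc, ← ENNReal.ofReal_mul (by positivity)]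
        congr 2
        rw [← hα, show (a - α) - 1 = (a - 1) + -α by ring, Real.rpow_add hτ', one_mul]
        ring
    _ = _ := by
        have h := Real.integral_rpow_mul_exp_neg_mul_Ioi (a := a - α) (by linarith) one_pos
        have hint : Integrable (fun τ : ℝ => τ ^ ((a - α) - 1) * Real.exp (-(1 * τ)))
            (volume.restrict (Set.Ioi 0)) := by
          by_contra hc
          rw [integral_undef hc] at h
          have : 0 < (1 / 1) ^ (a - α) * Real.Gamma (a - α) :=
            mul_pos (by positivity) (Real.Gamma_pos_of_pos (by linarith))
          linarith
        have hnn : 0 ≤ᵐ[volume.restrict (Set.Ioi (0 : ℝ))]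
            fun τ : ℝ => 3 * (τ ^ ((a - α) - 1) * Real.exp (-(1 * τ))) := by
          filter_upwards [ae_restrict_mem measurableSet_Ioi] with τ hτ
          have : 0 < τ := hτ
          show 0 ≤ 3 * (τ ^ ((a - α) - 1) * Real.exp (-(1 * τ)))
          positivity
        rw [lintegral_mul_const _ (by fun_prop),
          ← ofReal_integral_eq_lintegral_ofReal (hint.const_mul 3) hnn, integral_const_mul, h,
          ← mul_assoc, ← ENNReal.ofReal_mul (by positivity)]
        simp

theorem lintegral_fourierInv_sq_eq (f : 𝓢(V, ℂ)) (m : ℝ → ℝ≥0∞) :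
    ∫⁻ ξ, m ‖ξ‖ * ‖𝓕⁻ f ξ‖ₑ ^ 2 = ∫⁻ ξ, m ‖ξ‖ * ‖𝓕 f ξ‖ₑ ^ 2 := by
  rw [← lintegral_neg_eq_self]
  simp [SchwartzMap.fourier_coe, SchwartzMap.fourierInv_coe, Real.fourierInv_eq_fourier_neg]

end BesselBound

/-! ### Weighted Cauchy–Schwarz and pointwise bounds for the decaying symbol. -/

theorem ENNReal.lintegral_mul_mul_le_of_sq_le {α : Type*} [MeasurableSpace α] {μ : Measure α}
    {w u v A B : α → ℝ≥0∞} (hu : AEMeasurable u μ) (hv : AEMeasurable v μ)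
    (hA : AEMeasurable A μ) (hB : AEMeasurable B μ) (hw : ∀ x, w x ^ 2 ≤ u x * v x)
    {X Y : ℝ≥0∞} (hX : ∫⁻ x, u x * A x ^ 2 ∂μ ≤ X ^ 2) (hY : ∫⁻ x, v x * B x ^ 2 ∂μ ≤ Y ^ 2) :
    ∫⁻ x, w x * A x * B x ∂μ ≤ X * Y := by
  have hsq : ∀ z : ℝ≥0∞, (z ^ (1 / 2 : ℝ)) ^ (2 : ℝ) = z := fun z => by
    rw [← ENNReal.rpow_mul]; norm_num
  have hsq' : ∀ z : ℝ≥0∞, (z ^ 2) ^ (1 / 2 : ℝ) = z := fun z => by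
    rw [← ENNReal.rpow_natCast, ← ENNReal.rpow_mul]; norm_num
  calc ∫⁻ x, w x * A x * B x ∂μ
      ≤ ∫⁻ x, ((fun x => (u x * A x ^ 2) ^ (1 / 2 : ℝ)) *
          (fun x => (v x * B x ^ 2) ^ (1 / 2 : ℝ))) x ∂μ := by
        refine lintegral_mono fun x => ?_
        simp only [Pi.mul_apply]
        rw [← ENNReal.mul_rpow_of_nonneg _ _ (by norm_num), ← hsq' (w x * A x * B x)]
        refine ENNReal.rpow_le_rpow ?_ (by norm_num)
        calc (w x * A x * B x) ^ 2 = w x ^ 2 * (A x ^ 2 * B x ^ 2) := by ring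
          _ ≤ u x * v x * (A x ^ 2 * B x ^ 2) := mul_le_mul_left (hw x) _
          _ = _ := by ring
    _ ≤ _ := ENNReal.lintegral_mul_le_Lp_mul_Lq μ Real.HolderConjugate.two_two
        (by fun_prop) (by fun_prop)
    _ ≤ X * Y := by
        simp_rw [hsq]
        rw [← hsq' X, ← hsq' Y]
        gcongr

theorem exists_rpow_le_mul_exp (μ : ℝ) {c : ℝ} (hc : 0 < c) :
    ∃ C : ℝ, 0 < C ∧ ∀ y : ℝ, 1 ≤ y → y ^ μ ≤ C * Real.exp (c * y) := by
  obtain ⟨N, hN⟩ := exists_nat_ge μ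
  refine ⟨N.factorial / c ^ N, by positivity, fun y hy => ?_⟩
  have h1 : y ^ μ ≤ y ^ N := by
    rw [← Real.rpow_natCast]; exact Real.rpow_le_rpow_of_exponent_le hy hN
  have h2 := Real.pow_div_factorial_le_exp (c * y) (by positivity) N
  rw [div_le_iff₀ (by positivity), mul_pow] at h2
  rw [div_mul_eq_mul_div, le_div_iff₀ (by positivity)]
  nlinarith [mul_le_mul_of_nonneg_right h1 (by positivity : 0 ≤ c ^ N)]

/-- In the scaled variable X = r(1+t)^(1/k), r^s is X^s (1+t)^(-s/k). The exponential is dominated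
by a Gaussian in X because k ≥ 2, and half of that Gaussian absorbs X^s. -/
theorem exists_low_frequency_bound {s k c : ℝ} (hs : 0 ≤ s) (hk : 2 ≤ k) (hc : 0 < c) :
    ∃ C : ℝ, 0 < C ∧ ∀ t r : ℝ, 0 ≤ t → 0 ≤ r → r ≤ 1 →
      r ^ s * Real.exp (-(c * r ^ k * t)) ≤
        C * (1 + t) ^ (-(s / k)) * Real.exp (-(c / 2 * (1 + t) ^ (2 / k)) * r ^ 2) := by
  obtain ⟨C, hC, hb⟩ := exists_rpow_le_mul_exp (s / 2) (by positivity : 0 < c / 2)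
  refine ⟨C * Real.exp (5 / 2 * c), by positivity, fun t r ht hr hr1 => ?_⟩
  have hk0 : 0 < k := by linarith
  have ht1 : 0 < 1 + t := by linarith
  set X := r * (1 + t) ^ (1 / k) with hX
  have hX0 : 0 ≤ X := by positivity
  have hXk : X ^ k = r ^ k * (1 + t) := by
    rw [hX, Real.mul_rpow hr (by positivity), ← Real.rpow_mul ht1.le, one_div_mul_cancel hk0.ne',
      Real.rpow_one]
  have hX2 : X ^ 2 = r ^ 2 * (1 + t) ^ (2 / k) := by
    rw [hX, mul_pow, ← Real.rpow_natCast ((1 + t) ^ (1 / k)), ← Real.rpow_mul ht1.le]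
    congr 2; push_cast; ring
  have hXs : r ^ s = X ^ s * (1 + t) ^ (-(s / k)) := by
    rw [hX, Real.mul_rpow hr (by positivity), ← Real.rpow_mul ht1.le, mul_assoc,
      ← Real.rpow_add ht1]
    have : 1 / k * s + -(s / k) = 0 := by ring
    rw [this]; simp
  have hrk : r ^ k ≤ 1 := Real.rpow_le_one hr hr1 hk0.le
  have hXkX2 : X ^ 2 - 1 ≤ X ^ k := by
    rcases le_total X 1 with h | h
    · have := Real.rpow_nonneg hX0 k
      nlinarith
    · have := Real.rpow_le_rpow_of_exponent_le h hk
      rw [Real.rpow_two] at this; linarith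
  have hXsb : X ^ s ≤ C * Real.exp (c / 2 * (1 + X ^ 2)) := by
    refine le_trans ?_ (hb (1 + X ^ 2) (by nlinarith))
    have : X ^ s = (X ^ 2) ^ (s / 2) := by
      rw [← Real.rpow_natCast, ← Real.rpow_mul hX0]; congr 1; push_cast; ring
    rw [this]
    exact Real.rpow_le_rpow (by positivity) (by linarith) (by positivity)
  -- One factor e^c pays for replacing t by 1+t (as r ≤ 1), the other for X^k ≥ X² - 1.
  have hexp : Real.exp (-(c * r ^ k * t)) ≤ Real.exp (2 * c) * Real.exp (-c * X ^ 2) := by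
    rw [← Real.exp_add, Real.exp_le_exp]
    nlinarith
  rw [hXs]
  calc X ^ s * (1 + t) ^ (-(s / k)) * Real.exp (-(c * r ^ k * t))
      ≤ C * Real.exp (c / 2 * (1 + X ^ 2)) * (1 + t) ^ (-(s / k)) *
        (Real.exp (2 * c) * Real.exp (-c * X ^ 2)) := by gcongr
    _ = C * (1 + t) ^ (-(s / k)) *
        (Real.exp (c / 2 * (1 + X ^ 2)) * Real.exp (2 * c) * Real.exp (-c * X ^ 2)) := by ring
    _ = C * (1 + t) ^ (-(s / k)) *
        (Real.exp (5 / 2 * c) * Real.exp (-(c / 2 * (1 + t) ^ (2 / k)) * r ^ 2)) := by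
        congr 1
        rw [← Real.exp_add, ← Real.exp_add, ← Real.exp_add]
        congr 1
        have : -(c / 2 * (1 + t) ^ (2 / k)) * r ^ 2 = -(c / 2) * X ^ 2 := by rw [hX2]; ring
        rw [this]; ring
    _ = _ := by ring

/-- The exponent μ is free: for r ≥ 1 the rate `ρ` is at least 1, and e^(-ct) beats every power of
1+t. -/
theorem exists_multiplier_bound {s k c μ M : ℝ} (hs : 0 ≤ s) (hk : 2 ≤ k) (hc : 0 < c)
    (hM : 0 ≤ M) {ρ : ℝ → ℝ}
    (hρ1 : ∀ r, 0 ≤ r → r ≤ 1 → r ^ k ≤ ρ r) (hρ2 : ∀ r, 1 ≤ r → 1 ≤ ρ r) :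
    ∃ C : ℝ, 0 < C ∧ ∀ t r : ℝ, 0 ≤ t → 0 ≤ r →
      r ^ s * Real.exp (-(c * ρ r * t)) * (1 + r ^ 2) ^ (-(M / 2)) ≤
        C * (1 + t) ^ (-(s / k)) * Real.exp (-(c / 2 * (1 + t) ^ (2 / k)) * r ^ 2) +
        C * (1 + t) ^ (-μ) * (1 + r ^ 2) ^ (-((M - s) / 2)) := by
  obtain ⟨C₁, hC₁, h₁⟩ := exists_low_frequency_bound hs hk hc
  obtain ⟨C₂, hC₂, h₂⟩ := exists_rpow_le_mul_exp μ hc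
  set C₃ := C₂ * Real.exp c
  have hC₃ : 0 < C₃ := by positivity
  refine ⟨max C₁ C₃, lt_max_of_lt_left hC₁, fun t r ht hr => ?_⟩
  have ht1 : 0 < 1 + t := by linarith
  rcases le_total r 1 with hr1 | hr1
  · have e1 : (1 + r ^ 2) ^ (-(M / 2)) ≤ 1 :=
      Real.rpow_le_one_of_one_le_of_nonpos (by nlinarith) (by linarith)
    have e2 : Real.exp (-(c * ρ r * t)) ≤ Real.exp (-(c * r ^ k * t)) := by
      have := hρ1 r hr hr1
      gcongr
    have e3 := h₁ t r ht hr hr1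
    calc _ ≤ r ^ s * Real.exp (-(c * r ^ k * t)) * 1 := by gcongr
      _ ≤ C₁ * (1 + t) ^ (-(s / k)) * Real.exp (-(c / 2 * (1 + t) ^ (2 / k)) * r ^ 2) := by
        rw [mul_one]; exact e3
      _ ≤ max C₁ C₃ * (1 + t) ^ (-(s / k)) *
          Real.exp (-(c / 2 * (1 + t) ^ (2 / k)) * r ^ 2) := by
        gcongr; exact le_max_left _ _
      _ ≤ _ := le_add_of_nonneg_right (by positivity)
  · have e1 : r ^ s ≤ (1 + r ^ 2) ^ (s / 2) := by
      have : r ^ s = (r ^ 2) ^ (s / 2) := by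
        rw [← Real.rpow_natCast, ← Real.rpow_mul hr]; congr 1; push_cast; ring
      rw [this]
      exact Real.rpow_le_rpow (by positivity) (by linarith) (by positivity)
    have e2 : Real.exp (-(c * ρ r * t)) ≤ C₃ * (1 + t) ^ (-μ) := by
      have h3 := h₂ (1 + t) (by linarith)
      have h4 : Real.exp (-(c * ρ r * t)) ≤ Real.exp (-(c * t)) := by
        have := hρ2 r hr1
        rw [Real.exp_le_exp]
        nlinarith [mul_nonneg hc.le ht]
      refine h4.trans ?_
      rw [Real.rpow_neg ht1.le, ← div_eq_mul_inv, le_div_iff₀ (by positivity)]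
      calc Real.exp (-(c * t)) * (1 + t) ^ μ
          ≤ Real.exp (-(c * t)) * (C₂ * Real.exp (c * (1 + t))) := by gcongr
        _ = C₂ * (Real.exp (-(c * t)) * Real.exp (c * (1 + t))) := by ring
        _ = C₃ := by rw [← Real.exp_add]; congr 2; ring
    calc _ ≤ (1 + r ^ 2) ^ (s / 2) * (C₃ * (1 + t) ^ (-μ)) * (1 + r ^ 2) ^ (-(M / 2)) := by gcongr
      _ = C₃ * (1 + t) ^ (-μ) * ((1 + r ^ 2) ^ (s / 2) * (1 + r ^ 2) ^ (-(M / 2))) := by ring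
      _ = C₃ * (1 + t) ^ (-μ) * (1 + r ^ 2) ^ (-((M - s) / 2)) := by
        rw [← Real.rpow_add (by positivity)]; congr 2; ring
      _ ≤ max C₁ C₃ * (1 + t) ^ (-μ) * (1 + r ^ 2) ^ (-((M - s) / 2)) := by
        gcongr; exact le_max_right _ _
      _ ≤ _ := le_add_of_nonneg_left (by positivity)

/-! ### The bilinear estimate dual to the L^p–L^q bound. -/

section Bilinear

variable {V : Type*} [NormedAddCommGroup V] [InnerProductSpace ℝ V] [FiniteDimensional ℝ V]
  [MeasurableSpace V] [BorelSpace V]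

theorem exists_bilinear_multiplier_bound {s k c M : ℝ} (hs : 0 ≤ s) (hk : 2 ≤ k) (hc : 0 < c)
    {ρ : ℝ → ℝ} (hρ1 : ∀ r, 0 ≤ r → r ≤ 1 → r ^ k ≤ ρ r) (hρ2 : ∀ r, 1 ≤ r → 1 ≤ ρ r)
    {p p' : ℝ≥0∞} (hp1 : 1 ≤ p) (hp2 : p ≤ 2) (hp1' : 1 ≤ p') (hp2' : p' ≤ 2)
    (hM : s + Module.finrank ℝ V * (p⁻¹.toReal - 1 / 2) +
      Module.finrank ℝ V * (p'⁻¹.toReal - 1 / 2) < M) :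
    ∃ C : ℝ, 0 < C ∧ ∀ t : ℝ, 0 ≤ t → ∀ f φ : 𝓢(V, ℂ),
      ∫⁻ ξ, ENNReal.ofReal ((2 * Real.pi * ‖ξ‖) ^ s *
          Real.exp (-(c * ρ (2 * Real.pi * ‖ξ‖) * t)) *
          (1 + (2 * Real.pi * ‖ξ‖) ^ 2) ^ (-(M / 2))) * ‖𝓕 f ξ‖ₑ * ‖𝓕⁻ φ ξ‖ₑ ≤
        ENNReal.ofReal (C * (1 + t) ^ (-((s + Module.finrank ℝ V * (p⁻¹.toReal - 1 / 2) +
          Module.finrank ℝ V * (p'⁻¹.toReal - 1 / 2)) / k))) *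
          (eLpNorm f p volume * eLpNorm φ p' volume) := by
  have hα := rate_nonneg hp1 hp2 (Module.finrank ℝ V)
  have hβ := rate_nonneg hp1' hp2' (Module.finrank ℝ V)
  set α : ℝ := Module.finrank ℝ V * (p⁻¹.toReal - 1 / 2) with hα'
  set β : ℝ := Module.finrank ℝ V * (p'⁻¹.toReal - 1 / 2) with hβ'
  have hk0 : 0 < k := by linarith
  -- The surplus in M is shared equally, M - s = (α+ε) + (β+ε), which leaves both Bessel exponents
  -- admissible and positive even when α or β is 0.
  set ε := (M - s - α - β) / 2 with hε
  have hε0 : 0 < ε := by rw [hε]; linarith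
  obtain ⟨C, hC, hb⟩ := exists_multiplier_bound (μ := (s + α + β) / k) hs hk hc
    (by linarith : 0 ≤ M) hρ1 hρ2
  have hmeas : ∀ f : 𝓢(V, ℂ), Measurable fun ξ => ‖f ξ‖ₑ := fun f => by
    have := f.continuous; fun_prop
  set Ga : ℝ := (Real.Gamma (α + ε))⁻¹ * (3 * Real.Gamma (α + ε - α))
  set Gb : ℝ := (Real.Gamma (β + ε))⁻¹ * (3 * Real.Gamma (β + ε - β))
  have hGa : 0 < Ga := by
    have h1 := Real.Gamma_pos_of_pos (by linarith : 0 < α + ε)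
    have h2 := Real.Gamma_pos_of_pos (by linarith : 0 < α + ε - α)
    positivity
  have hGb : 0 < Gb := by
    have h1 := Real.Gamma_pos_of_pos (by linarith : 0 < β + ε)
    have h2 := Real.Gamma_pos_of_pos (by linarith : 0 < β + ε - β)
    positivity
  set D : ℝ := 3 * (c / 2) ^ (-((α + β) / 2))
  have hD : 0 < D := by positivity
  refine ⟨C * D + C * (√Ga * √Gb), by positivity, fun t ht f φ => ?_⟩
  have ht1 : 0 < 1 + t := by linarith
  -- With this T the Gaussian cost T^(-(α+β)/2) is a constant times (1+t)^(-(α+β)/k).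
  set T : ℝ := c / 2 * (1 + t) ^ (2 / k) with hT
  have hT0 : 0 < T := by positivity
  have hsq : ∀ (x : ℝ) (N : ℝ≥0∞), 0 ≤ x → (ENNReal.ofReal √x * N) ^ 2 = ENNReal.ofReal x * N ^ 2 :=
    fun x N hx => by rw [mul_pow, ← ENNReal.ofReal_pow (by positivity), Real.sq_sqrt hx]
  have hlow : ∫⁻ ξ, ENNReal.ofReal (Real.exp (-T * (2 * Real.pi * ‖ξ‖) ^ 2)) * ‖𝓕 f ξ‖ₑ *
      ‖𝓕⁻ φ ξ‖ₑ ≤ ENNReal.ofReal (3 * T ^ (-((α + β) / 2))) *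
        (eLpNorm f p volume * eLpNorm φ p' volume) := by
    have h1 := lintegral_exp_mul_fourier_sq_le f hT0 hp1 hp2
    have h2 := lintegral_exp_mul_fourier_sq_le φ hT0 hp1' hp2'
    rw [← lintegral_fourierInv_sq_eq φ
      (fun x => ENNReal.ofReal (Real.exp (-T * (2 * Real.pi * x) ^ 2)))] at h2
    rw [← hsq _ _ (by positivity)] at h1 h2
    refine (ENNReal.lintegral_mul_mul_le_of_sq_le (by fun_prop) (by fun_prop)
      (hmeas _).aemeasurable (hmeas _).aemeasurable (fun ξ => (sq _).le) h1 h2).trans (le_of_eq ?_)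
    rw [mul_mul_mul_comm, ← ENNReal.ofReal_mul (by positivity), ← Real.sqrt_mul (by positivity),
      ← hα', ← hβ']
    congr 2
    rw [Real.sqrt_eq_iff_eq_sq (by positivity) (by positivity), mul_pow,
      ← Real.rpow_natCast (T ^ _), ← Real.rpow_mul hT0.le, mul_mul_mul_comm, ← Real.rpow_add hT0]
    congr 1
    · norm_num
    · congr 1; push_cast; ring
  have hhigh : ∫⁻ ξ, ENNReal.ofReal ((1 + (2 * Real.pi * ‖ξ‖) ^ 2) ^ (-((M - s) / 2))) *
      ‖𝓕 f ξ‖ₑ * ‖𝓕⁻ φ ξ‖ₑ ≤ ENNReal.ofReal (√Ga * √Gb) *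
        (eLpNorm f p volume * eLpNorm φ p' volume) := by
    have h1 := lintegral_bessel_mul_fourier_sq_le f hp1 hp2 (a := α + ε) (by linarith) (by linarith)
    have h2 := lintegral_bessel_mul_fourier_sq_le φ hp1' hp2' (a := β + ε) (by linarith)
      (by linarith)
    rw [← lintegral_fourierInv_sq_eq φ
      (fun x => ENNReal.ofReal ((1 + (2 * Real.pi * x) ^ 2) ^ (-(β + ε))))] at h2
    rw [← hsq _ _ (by positivity)] at h1 h2
    refine (ENNReal.lintegral_mul_mul_le_of_sq_le (by fun_prop) (by fun_prop)
      (hmeas _).aemeasurable (hmeas _).aemeasurable (fun ξ => ?_) h1 h2).trans (le_of_eq ?_)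
    · rw [← ENNReal.ofReal_pow (by positivity), ← ENNReal.ofReal_mul (by positivity),
        ← Real.rpow_natCast, ← Real.rpow_mul (by positivity), ← Real.rpow_add (by positivity)]
      refine ENNReal.ofReal_le_ofReal (le_of_eq ?_)
      congr 1; rw [hε]; push_cast; ring
    · rw [mul_mul_mul_comm, ← ENNReal.ofReal_mul (by positivity)]
  calc _ ≤ ∫⁻ ξ, (ENNReal.ofReal (C * (1 + t) ^ (-(s / k))) *
        (ENNReal.ofReal (Real.exp (-T * (2 * Real.pi * ‖ξ‖) ^ 2)) * ‖𝓕 f ξ‖ₑ * ‖𝓕⁻ φ ξ‖ₑ) +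
        ENNReal.ofReal (C * (1 + t) ^ (-((s + α + β) / k))) *
        (ENNReal.ofReal ((1 + (2 * Real.pi * ‖ξ‖) ^ 2) ^ (-((M - s) / 2))) *
          ‖𝓕 f ξ‖ₑ * ‖𝓕⁻ φ ξ‖ₑ)) := by
        refine lintegral_mono fun ξ => ?_
        have := ENNReal.ofReal_le_ofReal (hb t (2 * Real.pi * ‖ξ‖) ht (by positivity))
        rw [ENNReal.ofReal_add (by positivity) (by positivity),
          ENNReal.ofReal_mul (p := C * (1 + t) ^ (-(s / k))) (by positivity),
          ENNReal.ofReal_mul (p := C * (1 + t) ^ (-((s + α + β) / k))) (by positivity)] at this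
        refine (mul_le_mul_left (mul_le_mul_left this _) _).trans (le_of_eq ?_)
        ring
    _ ≤ ENNReal.ofReal (C * (1 + t) ^ (-(s / k))) * (ENNReal.ofReal (3 * T ^ (-((α + β) / 2))) *
        (eLpNorm f p volume * eLpNorm φ p' volume)) +
        ENNReal.ofReal (C * (1 + t) ^ (-((s + α + β) / k))) * (ENNReal.ofReal (√Ga * √Gb) *
        (eLpNorm f p volume * eLpNorm φ p' volume)) := by
        have m1 := hmeas (𝓕 f)
        have m2 := hmeas (𝓕⁻ φ)
        rw [lintegral_add_left (by fun_prop), lintegral_const_mul' _ _ ENNReal.ofReal_ne_top,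
          lintegral_const_mul' _ _ ENNReal.ofReal_ne_top]
        gcongr
    _ = _ := by
        generalize eLpNorm f p volume * eLpNorm φ p' volume = N
        rw [← mul_assoc, ← mul_assoc, ← ENNReal.ofReal_mul (by positivity),
          ← ENNReal.ofReal_mul (by positivity), ← add_mul,
          ← ENNReal.ofReal_add (by positivity) (by positivity)]
        congr 2
        have : T ^ (-((α + β) / 2)) = (c / 2) ^ (-((α + β) / 2)) * (1 + t) ^ (-((α + β) / k)) := by
          rw [hT, Real.mul_rpow (by positivity) (by positivity), ← Real.rpow_mul ht1.le]
          congr 2; field_simp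
        have e2 : (1 + t) ^ (-((s + α + β) / k)) =
            (1 + t) ^ (-(s / k)) * (1 + t) ^ (-((α + β) / k)) := by
          rw [← Real.rpow_add ht1]; congr 1; field_simp; ring
        rw [this, e2]
        ring

end Bilinear

/-! ### L^q norms from pairings with Schwartz functions. -/

section Duality

variable {V : Type*} [NormedAddCommGroup V] [InnerProductSpace ℝ V] [FiniteDimensional ℝ V]
  [MeasurableSpace V] [BorelSpace V]

/-- Schwartz functions are dense in L^q' for q' < ∞, and pairing with a fixed g in L^q is continuous
there. -/
theorem enorm_integral_mul_le_of_schwartz {q q' : ℝ≥0∞} [q'.HolderConjugate q]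
    (hq' : q' ≠ ∞) {g : V → ℂ} (hg : MemLp g q) {B : ℝ} (hB : 0 ≤ B)
    (h : ∀ φ : 𝓢(V, ℂ), ‖∫ x, φ x * g x‖ₑ ≤ ENNReal.ofReal B * eLpNorm φ q' volume)
    {f : V → ℂ} (hf : MemLp f q') :
    ‖∫ x, f x * g x‖ₑ ≤ ENNReal.ofReal B * eLpNorm f q' volume := by
  have : Fact (1 ≤ q') := ⟨ENNReal.HolderConjugate.one_le q' q⟩
  have : Fact (1 ≤ q) := ⟨ENNReal.HolderConjugate.one_le q q'⟩
  set P := (ContinuousLinearMap.mul ℂ ℂ).lpPairing (volume : Measure V) q' q with hP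
  have hPe : ∀ {f : V → ℂ} (hf : MemLp f q'), P hf.toLp hg.toLp = ∫ x, f x * g x := fun hf => by
    rw [hP, ContinuousLinearMap.lpPairing_eq_integral]
    refine integral_congr_ae ?_
    filter_upwards [hf.coeFn_toLp, hg.coeFn_toLp] with x h1 h2
    simp [h1, h2]
  have key : ∀ F : Lp ℂ q' (volume : Measure V), ‖P F hg.toLp‖ ≤ B * ‖F‖ := by
    intro F
    refine (SchwartzMap.denseRange_toLpCLM (E := V) (F := ℂ) (μ := volume) hq').induction_on
      (p := fun F => ‖P F hg.toLp‖ ≤ B * ‖F‖) F (isClosed_le (by fun_prop) (by fun_prop)) fun φ => ?_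
    have h1 := h φ
    rw [← hPe (φ.memLp q' volume), ← ofReal_norm,
      ← ENNReal.ofReal_toReal (φ.memLp q' volume).2.ne, ← ENNReal.ofReal_mul hB,
      ENNReal.ofReal_le_ofReal_iff (by positivity)] at h1
    rw [SchwartzMap.toLpCLM_apply, SchwartzMap.norm_toLp]
    exact h1
  have h1 := key hf.toLp
  rw [hPe hf, Lp.norm_toLp] at h1
  rw [← ofReal_norm, ← ENNReal.ofReal_toReal hf.2.ne, ← ENNReal.ofReal_mul hB]
  exact ENNReal.ofReal_le_ofReal h1

theorem eLpNorm_top_le_of_pairing {g : V → ℂ} (hg : MemLp g ∞) {B : ℝ}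
    (h : ∀ f : V → ℂ, MemLp f 1 →
      ‖∫ x, f x * g x‖ₑ ≤ ENNReal.ofReal B * eLpNorm f 1 volume) :
    eLpNorm g ∞ volume ≤ ENNReal.ofReal B := by
  rw [eLpNorm_exponent_top]
  refine essSup_le_of_ae_le _ ?_
  refine ae_le_of_forall_setLIntegral_le_of_sigmaFinite₀ hg.1.enorm fun A hA hAf => ?_
  have hgm : AEMeasurable g := hg.1.aemeasurable
  -- The conjugate phase of g on a set of finite measure, so that f·g = |g| on A; where g vanishes,
  -- the convention 0/0 = 0 is harmless.
  set f : V → ℂ := A.indicator fun x => starRingEnd ℂ (g x) / ‖g x‖ with hf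
  have hfm : AEStronglyMeasurable f volume := by
    refine AEStronglyMeasurable.indicator (AEMeasurable.aestronglyMeasurable ?_) hA
    exact (Complex.continuous_conj.measurable.comp_aemeasurable hgm).div (by fun_prop)
  have hfle : ∀ x, ‖f x‖ₑ ≤ A.indicator 1 x := fun x => by
    by_cases hx : x ∈ A
    · simp only [hf, Set.indicator_of_mem hx, Pi.one_apply]
      rw [← ofReal_norm, ← ENNReal.ofReal_one]
      refine ENNReal.ofReal_le_ofReal ?_
      simpa using div_self_le_one ‖g x‖
    · simp [hf, hx]
  have hf1 : eLpNorm f 1 volume ≤ volume A := by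
    rw [eLpNorm_one_eq_lintegral_enorm, ← lintegral_indicator_one hA]
    exact lintegral_mono hfle
  have hfp : MemLp f 1 := ⟨hfm, hf1.trans_lt hAf⟩
  have h1 := (h f hfp).trans (mul_le_mul_right hf1 _)
  have h2 : ∀ x, f x * g x = ((A.indicator (fun x => ‖g x‖) x : ℝ) : ℂ) := fun x => by
    by_cases hx : x ∈ A
    · simp only [hf, Set.indicator_of_mem hx]
      rcases eq_or_ne (g x) 0 with h0 | h0
      · simp [h0]
      · have : ((‖g x‖ : ℝ) : ℂ) ≠ 0 := by simpa using h0
        rw [div_mul_eq_mul_div, mul_comm, Complex.mul_conj, Complex.normSq_eq_norm_sq,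
          div_eq_iff this]
        push_cast; ring
    · simp [hf, hx]
  have : IsFiniteMeasure (volume.restrict A) := isFiniteMeasure_restrict.2 hAf.ne
  have hgA : IntegrableOn g A volume :=
    memLp_one_iff_integrable.1 ((hg.restrict A).mono_exponent le_top)
  rw [setLIntegral_const]
  refine le_trans (le_of_eq ?_) h1
  simp_rw [h2]
  rw [integral_complex_ofReal, ← ofReal_norm, Complex.norm_real, integral_indicator hA,
    Real.norm_of_nonneg (by positivity), ofReal_integral_eq_lintegral_ofReal hgA.norm
    (Filter.Eventually.of_forall fun x => norm_nonneg _)]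
  simp_rw [ofReal_norm]

theorem eLpNorm_le_of_pairing {q q' : ℝ≥0∞} [q'.HolderConjugate q] (hq2 : 2 ≤ q) (hq : q ≠ ∞)
    (hq' : q' ≠ ∞) {g : V → ℂ} (hg : MemLp g q) {B : ℝ}
    (h : ∀ f : V → ℂ, MemLp f q' →
      ‖∫ x, f x * g x‖ₑ ≤ ENNReal.ofReal B * eLpNorm f q' volume) :
    eLpNorm g q volume ≤ ENNReal.ofReal B := by
  have hq0 : q ≠ 0 := (zero_lt_two.trans_le hq2).ne'
  have hq0' : q' ≠ 0 := (zero_lt_one.trans_le (ENNReal.HolderConjugate.one_le q' q)).ne'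
  have hconj := ENNReal.HolderConjugate.toReal_of_ne_top (p := q') (q := q) hq' hq
  set Q := q.toReal with hQ
  set Q' := q'.toReal with hQ'
  have hQ2 : 2 ≤ Q := by simpa using ENNReal.toReal_mono hq hq2
  have hQ0 : 0 < Q := by linarith
  have hQ0' : 0 < Q' := hconj.pos
  have hgm : AEMeasurable g := hg.1.aemeasurable
  -- The extremizer in Hölder's inequality: f·g = |g|^Q and |f|^Q' = |g|^Q. Finiteness of ∫|g|^Q,
  -- known beforehand, permits the final division.
  set f : V → ℂ := fun x => starRingEnd ℂ (g x) * ((‖g x‖ ^ (Q - 2) : ℝ) : ℂ) with hf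
  have hfm : AEStronglyMeasurable f volume := by
    refine AEMeasurable.aestronglyMeasurable ?_
    exact (Complex.continuous_conj.measurable.comp_aemeasurable hgm).mul (by fun_prop)
  have hfn : ∀ x, ‖f x‖ₑ ^ Q' = ‖g x‖ₑ ^ Q := fun x => by
    have : ‖f x‖ = ‖g x‖ ^ (Q - 1) := by
      simp only [hf, norm_mul, RCLike.norm_conj, Complex.norm_real]
      rw [Real.norm_of_nonneg (by positivity)]
      rcases eq_or_ne ‖g x‖ 0 with h0 | h0
      · rw [h0, zero_mul, Real.zero_rpow (by linarith)]
      · have hpos : 0 < ‖g x‖ := lt_of_le_of_ne (norm_nonneg _) h0.symm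
        nth_rewrite 1 [← Real.rpow_one ‖g x‖]
        rw [← Real.rpow_add hpos]; congr 1; ring
    rw [← ofReal_norm, this, ← ofReal_norm (g x), ENNReal.ofReal_rpow_of_nonneg (by positivity) hQ0'.le,
      ENNReal.ofReal_rpow_of_nonneg (by positivity) hQ0.le, ← Real.rpow_mul (by positivity)]
    congr 2
    exact hconj.symm.sub_one_mul_conj
  set I := ∫⁻ x, ‖g x‖ₑ ^ Q with hI
  have hgI : eLpNorm g q volume = I ^ (1 / Q) := eLpNorm_eq_lintegral_rpow_enorm_toReal hq0 hq
  have hfI : eLpNorm f q' volume = I ^ (1 / Q') := by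
    rw [eLpNorm_eq_lintegral_rpow_enorm_toReal hq0' hq']
    simp_rw [← hQ', hfn, hI]
  have hItop : I ≠ ∞ := by
    have := hg.2.ne
    rw [hgI] at this
    contrapose! this
    rw [this, ENNReal.top_rpow_of_pos (by positivity)]
  have hfp : MemLp f q' := ⟨hfm, by
    rw [hfI]; exact (ENNReal.rpow_lt_top_of_nonneg (by positivity) hItop)⟩
  have h1 := h f hfp
  have h2 : ∀ x, f x * g x = ((‖g x‖ ^ Q : ℝ) : ℂ) := fun x => by
    simp only [hf]
    rw [mul_right_comm, mul_comm (starRingEnd ℂ _), Complex.mul_conj, Complex.normSq_eq_norm_sq,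
      ← Complex.ofReal_mul]
    congr 1
    rcases eq_or_ne ‖g x‖ 0 with h0 | h0
    · rw [h0, Real.zero_rpow hQ0.ne']; simp
    · have hpos : 0 < ‖g x‖ := lt_of_le_of_ne (norm_nonneg _) h0.symm
      rw [← Real.rpow_two, ← Real.rpow_add hpos]; congr 1; ring
  have h3 : ‖∫ x, f x * g x‖ₑ = I := by
    simp_rw [h2]
    rw [integral_complex_ofReal, ← ofReal_norm, Complex.norm_real,
      Real.norm_of_nonneg (integral_nonneg fun x => by positivity),
      ofReal_integral_eq_lintegral_ofReal (hg.integrable_norm_rpow hq0 hq)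
      (Filter.Eventually.of_forall fun x => by positivity)]
    refine lintegral_congr fun x => ?_
    rw [← ENNReal.ofReal_rpow_of_nonneg (norm_nonneg _) hQ0.le, ofReal_norm]
  rw [h3, hfI] at h1
  rw [hgI]
  rcases eq_or_ne I 0 with h0 | h0
  · rw [h0, ENNReal.zero_rpow_of_pos (by positivity)]; exact zero_le
  · have h4 : I = I ^ (1 / Q) * I ^ (1 / Q') := by
      rw [← ENNReal.rpow_add _ _ h0 hItop]
      have := hconj.inv_add_inv_eq_one
      rw [one_div, one_div, add_comm, this, ENNReal.rpow_one]
    have h5 : I ^ (1 / Q) * I ^ (1 / Q') ≤ ENNReal.ofReal B * I ^ (1 / Q') := by rwa [← h4]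
    have h6 : I ^ (1 / Q') ≠ 0 := by simp [h0, hItop]
    have h7 : I ^ (1 / Q') ≠ ∞ := (ENNReal.rpow_lt_top_of_nonneg (by positivity) hItop).ne
    exact (ENNReal.mul_le_mul_iff_left h6 h7).1 h5

theorem eLpNorm_le_of_schwartz_pairing {q q' : ℝ≥0∞} [q'.HolderConjugate q] (hq2 : 2 ≤ q)
    {g : V → ℂ} (hg : MemLp g q) {B : ℝ} (hB : 0 ≤ B)
    (h : ∀ φ : 𝓢(V, ℂ), ‖∫ x, φ x * g x‖ₑ ≤ ENNReal.ofReal B * eLpNorm φ q' volume) :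
    eLpNorm g q volume ≤ ENNReal.ofReal B := by
  have hq' : q' ≠ ∞ := by
    rintro rfl
    have := ENNReal.HolderConjugate.inv_add_inv_eq_one ∞ q
    simp only [ENNReal.inv_top, zero_add, ENNReal.inv_eq_one] at this
    rw [this] at hq2
    norm_num at hq2
  rcases eq_or_ne q ∞ with rfl | hq
  · have : q' = 1 := ENNReal.HolderConjugate.unique ∞ q' 1
    subst this
    exact eLpNorm_top_le_of_pairing hg fun f hf => enorm_integral_mul_le_of_schwartz hq' hg hB h hf
  · exact eLpNorm_le_of_pairing hq2 hq hq' hg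
      fun f hf => enorm_integral_mul_le_of_schwartz hq' hg hB h hf

end Duality

/-! ### From weak equations to strong L² derivatives on bounded sets of frequencies. -/

section StrongDerivative

variable {V : Type*} [NormedAddCommGroup V] [InnerProductSpace ℝ V] [FiniteDimensional ℝ V]
  [MeasurableSpace V] [BorelSpace V]

/-- Multiplication by a bounded function, as an operator on `L²`. -/
noncomputable def mulOp {m : V → ℂ} (hm : MemLp m ∞) :
    Lp ℂ 2 (volume : Measure V) →L[ℂ] Lp ℂ 2 (volume : Measure V) :=
  (ContinuousLinearMap.mul ℂ ℂ).holderL volume ∞ 2 2 hm.toLp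

theorem coeFn_mulOp {m : V → ℂ} (hm : MemLp m ∞) (F : Lp ℂ 2 (volume : Measure V)) :
    mulOp hm F =ᵐ[volume] fun ξ => m ξ * F ξ := by
  have h := (ContinuousLinearMap.mul ℂ ℂ).coeFn_holder (r := 2) hm.toLp F
  filter_upwards [h, hm.coeFn_toLp] with ξ h1 h2
  rw [← h2]
  exact h1

theorem integral_ofReal_mul_eq_inner {ψ : V → ℝ} (hψ : MemLp (fun x => (ψ x : ℂ)) 2)
    (F : Lp ℂ 2 (volume : Measure V)) :
    ∫ x, (ψ x : ℂ) * F x = inner ℂ hψ.toLp F := by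
  rw [L2.inner_def]
  refine integral_congr_ae ?_
  filter_upwards [hψ.coeFn_toLp] with x hx
  rw [hx]; simp [mul_comm]

/-- Each tested equation is integrated in time. Then G(τ) - G(0) - ∫N is orthogonal to all test
functions supported in U, hence vanishes a.e. on U, and the L²-valued fundamental theorem of
calculus gives the derivative. -/
theorem hasDerivAt_mulOp_of_weak {U : Set V} (hU : IsOpen U)
    (hχ : MemLp (U.indicator fun _ => (1 : ℂ)) ∞)
    {G N : ℝ → Lp ℂ 2 (volume : Measure V)} (hG : ContinuousOn G (Set.Ici 0))
    (hN : ContinuousOn N (Set.Ici 0))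
    (h : ∀ ψ : V → ℝ, ContDiff ℝ (⊤ : ℕ∞) ψ → HasCompactSupport ψ → tsupport ψ ⊆ U → ∀ t, 0 < t →
      HasDerivAt (fun τ => ∫ x, (ψ x : ℂ) * G τ x) (∫ x, (ψ x : ℂ) * N t x) t)
    {t : ℝ} (ht : 0 < t) :
    HasDerivAt (fun τ => mulOp hχ (G τ)) (mulOp hχ (N t)) t := by
  -- Constant extension to negative times, which makes the integrand continuous on all of ℝ.
  set N' : ℝ → Lp ℂ 2 (volume : Measure V) := fun τ => N (max τ 0) with hN'
  have hN'c : Continuous N' := hN.comp_continuous (by fun_prop) fun τ => Set.mem_Ici.2 (le_max_right _ _)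
  have hNN' : ∀ τ, 0 ≤ τ → N' τ = N τ := fun τ hτ => by simp [hN', max_eq_left hτ]
  have key : ∀ τ, 0 ≤ τ → mulOp hχ (G τ - G 0 - ∫ r in 0..τ, N' r) = 0 := by
    intro τ hτ
    set D := G τ - G 0 - ∫ r in 0..τ, N' r with hD
    have hz : ∀ᵐ x, x ∈ U → D x = 0 := by
      refine hU.ae_eq_zero_of_integral_contDiff_smul_eq_zero
        (((Lp.memLp D).locallyIntegrable (by norm_num)).locallyIntegrableOn U)
        fun ψ hψ1 hψ2 hψ3 => ?_
      have hψ : MemLp (fun x => (ψ x : ℂ)) 2 (volume : Measure V) := by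
        have hc : Continuous fun x => (ψ x : ℂ) := Complex.continuous_ofReal.comp hψ1.continuous
        exact hc.memLp_of_hasCompactSupport (hψ2.comp_left (g := fun y : ℝ => (y : ℂ)) rfl)
      have hw : ∀ r, 0 < r → HasDerivAt (fun τ => innerSL ℂ hψ.toLp (G τ))
          (innerSL ℂ hψ.toLp (N' r)) r := fun r hr => by
        have := h ψ hψ1 hψ2 hψ3 r hr
        simp_rw [integral_ofReal_mul_eq_inner hψ] at this
        rw [hNN' r hr.le]
        exact this
      have hFTC := intervalIntegral.integral_eq_sub_of_hasDerivAt_of_le hτ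
        (f := fun τ => innerSL ℂ hψ.toLp (G τ)) (f' := fun r => innerSL ℂ hψ.toLp (N' r))
        (((innerSL ℂ hψ.toLp).continuous.comp_continuousOn hG).mono Set.Icc_subset_Ici_self)
        (fun r hr => hw r hr.1)
        (((innerSL ℂ hψ.toLp).continuous.comp hN'c).intervalIntegrable 0 τ)
      rw [ContinuousLinearMap.intervalIntegral_comp_comm _ (hN'c.intervalIntegrable 0 τ)] at hFTC
      have hD0 : innerSL ℂ hψ.toLp D = 0 := by
        rw [hD, map_sub, map_sub, hFTC]; ring
      simp only [Complex.real_smul]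
      rw [integral_ofReal_mul_eq_inner hψ]
      exact hD0
    refine Lp.ext ?_
    filter_upwards [hz, coeFn_mulOp hχ D, Lp.coeFn_zero ℂ 2 (volume : Measure V)] with x h1 h2 h3
    rw [h2, h3]
    by_cases hx : x ∈ U
    · simp [h1 hx]
    · simp [hx]
  have heq : (fun τ => mulOp hχ (G τ)) =ᶠ[nhds t]
      fun τ => mulOp hχ (G 0) + mulOp hχ (∫ r in 0..τ, N' r) := by
    filter_upwards [lt_mem_nhds ht] with τ hτ
    have := key τ hτ.le
    rw [map_sub, map_sub, sub_eq_zero, sub_eq_iff_eq_add] at this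
    rw [this, add_comm]
  refine HasDerivAt.congr_of_eventuallyEq ?_ heq
  rw [← hNN' t ht.le]
  have h1 := (hN'c.integral_hasStrictDerivAt 0 t).hasDerivAt
  have h2 := ((mulOp hχ).restrictScalars ℝ).hasFDerivAt.comp_hasDerivAt t h1
  exact h2.const_add _

theorem integrable_mul_re_conj_mul {m : V → ℝ} (hm : MemLp (fun ξ => (m ξ : ℂ)) ∞)
    (F G : Lp ℂ 2 (volume : Measure V)) :
    Integrable fun ξ => m ξ * (starRingEnd ℂ (F ξ) * G ξ).re := by
  have h := (L2.integrable_inner (𝕜 := ℂ) F (mulOp hm G)).re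
  refine h.congr ?_
  filter_upwards [coeFn_mulOp hm G] with ξ h1
  rw [h1]
  simp [RCLike.inner_apply]
  ring

theorem integral_mul_re_conj_mul {m : V → ℝ} (hm : MemLp (fun ξ => (m ξ : ℂ)) ∞)
    (F G : Lp ℂ 2 (volume : Measure V)) :
    ∫ ξ, m ξ * (starRingEnd ℂ (F ξ) * G ξ).re = (inner ℂ F (mulOp hm G)).re := by
  rw [L2.inner_def]
  have := integral_re (L2.integrable_inner (𝕜 := ℂ) F (mulOp hm G))
  simp only [RCLike.re_to_complex] at this
  rw [← this]
  refine integral_congr_ae ?_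
  filter_upwards [coeFn_mulOp hm G] with ξ h1
  rw [h1]
  simp [RCLike.inner_apply]
  ring

section QuadForm

variable {ι : Type*} [Fintype ι] {m : ι → ι → V → ℝ}

theorem integrable_quadForm (hm : ∀ i j, MemLp (fun ξ => (m i j ξ : ℂ)) ∞)
    (X Y : ι → Lp ℂ 2 (volume : Measure V)) :
    Integrable fun ξ => ∑ i, ∑ j, m i j ξ * (starRingEnd ℂ (X i ξ) * Y j ξ).re :=
  integrable_finsetSum _ fun i _ => integrable_finsetSum _ fun j _ =>
    integrable_mul_re_conj_mul (hm i j) _ _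

theorem integral_quadForm (hm : ∀ i j, MemLp (fun ξ => (m i j ξ : ℂ)) ∞)
    (X Y : ι → Lp ℂ 2 (volume : Measure V)) :
    ∫ ξ, ∑ i, ∑ j, m i j ξ * (starRingEnd ℂ (X i ξ) * Y j ξ).re =
      ∑ i, ∑ j, (inner ℂ (X i) (mulOp (hm i j) (Y j))).re := by
  rw [integral_finsetSum _ fun i _ => integrable_finsetSum _ fun j _ =>
    integrable_mul_re_conj_mul (hm i j) _ _]
  refine Finset.sum_congr rfl fun i _ => ?_
  rw [integral_finsetSum _ fun j _ => integrable_mul_re_conj_mul (hm i j) _ _]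
  exact Finset.sum_congr rfl fun j _ => integral_mul_re_conj_mul (hm i j) _ _

theorem continuousOn_integral_quadForm (hm : ∀ i j, MemLp (fun ξ => (m i j ξ : ℂ)) ∞)
    {X : ι → ℝ → Lp ℂ 2 (volume : Measure V)} {S : Set ℝ} (hX : ∀ i, ContinuousOn (X i) S) :
    ContinuousOn (fun τ => ∫ ξ, ∑ i, ∑ j, m i j ξ * (starRingEnd ℂ (X i τ ξ) * X j τ ξ).re) S := by
  simp_rw [integral_quadForm hm (fun i => X i _) (fun i => X i _)]
  refine continuousOn_finsetSum _ fun i _ => continuousOn_finsetSum _ fun j _ => ?_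
  exact Complex.continuous_re.comp_continuousOn
    ((hX i).inner ((mulOp (hm i j)).continuous.comp_continuousOn (hX j)))

theorem hasDerivAt_integral_quadForm (hm : ∀ i j, MemLp (fun ξ => (m i j ξ : ℂ)) ∞)
    {X : ι → ℝ → Lp ℂ 2 (volume : Measure V)} {X' : ι → Lp ℂ 2 (volume : Measure V)} {t : ℝ}
    (hX : ∀ i, HasDerivAt (X i) (X' i) t) :
    HasDerivAt (fun τ => ∫ ξ, ∑ i, ∑ j, m i j ξ * (starRingEnd ℂ (X i τ ξ) * X j τ ξ).re)
      (∫ ξ, ((∑ i, ∑ j, m i j ξ * (starRingEnd ℂ (X i t ξ) * X' j ξ).re) +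
        ∑ i, ∑ j, m i j ξ * (starRingEnd ℂ (X' i ξ) * X j t ξ).re)) t := by
  rw [integral_add (integrable_quadForm hm (fun i => X i t) X')
    (integrable_quadForm hm X' (fun i => X i t))]
  rw [integral_quadForm hm (fun i => X i t) X', integral_quadForm hm X' (fun i => X i t)]
  simp_rw [integral_quadForm hm (fun i => X i _) (fun i => X i _)]
  rw [← Finset.sum_add_distrib]
  refine HasDerivAt.fun_sum fun i _ => ?_
  rw [← Finset.sum_add_distrib]
  refine HasDerivAt.fun_sum fun j _ => ?_
  have h1 := ((mulOp (hm i j)).restrictScalars ℝ).hasFDerivAt.comp_hasDerivAt t (hX j)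
  have h2 := (hX i).inner ℂ h1
  exact Complex.reCLM.hasFDerivAt.comp_hasDerivAt t h2

end QuadForm

end StrongDerivative

/-! ### The Lyapunov form of the frequency-wise ODE. -/

/-- The Fourier-side vector field of the plate system, at a frequency where `-Δ` and the damping
operator have the symbols `a` and `d`; the components stand for `|D|²u`, `u_t` and `θ`. -/
def plateField (a d : ℝ) (z : Fin 3 → ℂ) : Fin 3 → ℂ :=
  ![a * z 1, -(a * z 0) + a * z 2 - d * z 1, -(a * z 2) - a * z 1]

/-- The coefficients of the Lyapunov form of the plate system. -/
noncomputable def lyapCoeff (b : ℝ) : Fin 3 → Fin 3 → ℝ :=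
  ![![1, b / 64, 0], ![b / 64, 1, b / 16], ![0, b / 16, 1]]

/-- Half the energy derivative is -dy² - az². The derivative of yz contains -ay² and that of xy
contains -ax², so the weights b/16 and b/64 produce the missing dissipation; their unequal sizes let
the ay² from xy be absorbed by the yz term. The damping terms b·d·yz and b·d·xy are absorbed by dy²
together with b²d ≤ ab. -/
theorem real_lyapunov_decay {a b d : ℝ} (x y z : ℝ) (ha : 0 ≤ a) (hb : 0 ≤ b) (hb1 : b ≤ 1)
    (hd : 0 ≤ d) (hbd : b * d ≤ a) :
    2 * (x * (a * y) + y * (-(a * x) + a * z - d * y) + z * (-(a * z) - a * y) +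
      b / 64 * (x * (-(a * x) + a * z - d * y) + a * y * y) +
      b / 16 * (z * (-(a * x) + a * z - d * y) + (-(a * z) - a * y) * y)) ≤
    -(a * b / 256) * (x * x + y * y + z * z + 2 * (b / 64 * (x * y) + b / 16 * (y * z))) := by
  have hab : 0 ≤ a * b := mul_nonneg ha hb
  have g1 := mul_nonneg hab (sq_nonneg (y + 2 * z))
  have g2 := mul_nonneg hab (sq_nonneg (x + 8 * z))
  have g3 := mul_nonneg (mul_nonneg ha (sub_nonneg.2 hb1)) (sq_nonneg z)
  have g4 := mul_nonneg hd (sq_nonneg (y + b * z))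
  have g5 := mul_nonneg (mul_nonneg hb (sub_nonneg.2 hbd)) (sq_nonneg z)
  have g6 := mul_nonneg hab (sq_nonneg (x - 2 * z))
  have g7 := mul_nonneg hd (sq_nonneg (y + b * x / 2))
  have g8 := mul_nonneg (mul_nonneg hb (sub_nonneg.2 hbd)) (sq_nonneg x)
  have p1 := mul_nonneg hab (sq_nonneg x)
  have p2 := mul_nonneg hab (sq_nonneg y)
  have p3 := mul_nonneg ha (sq_nonneg z)
  have p4 := mul_nonneg hd (sq_nonneg y)
  have q1 := mul_nonneg (mul_nonneg hab hb) (sq_nonneg (x - y))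
  have q2 := mul_nonneg (mul_nonneg hab hb) (sq_nonneg (y - z))
  have q3 := mul_nonneg (mul_nonneg hab (sub_nonneg.2 hb1)) (sq_nonneg x)
  have q4 := mul_nonneg (mul_nonneg hab (sub_nonneg.2 hb1)) (sq_nonneg y)
  have q5 := mul_nonneg (mul_nonneg hab (sub_nonneg.2 hb1)) (sq_nonneg z)
  linarith

theorem lyap_decay {a b d : ℝ} (z : Fin 3 → ℂ) (ha : 0 ≤ a) (hb : 0 ≤ b) (hb1 : b ≤ 1)
    (hd : 0 ≤ d) (hbd : b * d ≤ a) :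
    (∑ i, ∑ j, lyapCoeff b i j * (starRingEnd ℂ (z i) * plateField a d z j).re) +
      ∑ i, ∑ j, lyapCoeff b i j * (starRingEnd ℂ (plateField a d z i) * z j).re ≤
    -(a * b / 256) * ∑ i, ∑ j, lyapCoeff b i j * (starRingEnd ℂ (z i) * z j).re := by
  have h1 := real_lyapunov_decay (z 0).re (z 1).re (z 2).re ha hb hb1 hd hbd
  have h2 := real_lyapunov_decay (z 0).im (z 1).im (z 2).im ha hb hb1 hd hbd
  simp [Fin.sum_univ_three, lyapCoeff, plateField]
  linarith

theorem lyap_bounds {b : ℝ} (z : Fin 3 → ℂ) (hb : 0 ≤ b) (hb1 : b ≤ 1) :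
    1 / 2 * ∑ i, ‖z i‖ ^ 2 ≤ ∑ i, ∑ j, lyapCoeff b i j * (starRingEnd ℂ (z i) * z j).re ∧
      ∑ i, ∑ j, lyapCoeff b i j * (starRingEnd ℂ (z i) * z j).re ≤ 2 * ∑ i, ‖z i‖ ^ 2 := by
  have aux : ∀ x y w : ℝ, 1 / 2 * (x * x + y * y + w * w) ≤
      x * x + y * y + w * w + 2 * (b / 64 * (x * y) + b / 16 * (y * w)) ∧
      x * x + y * y + w * w + 2 * (b / 64 * (x * y) + b / 16 * (y * w)) ≤
      2 * (x * x + y * y + w * w) := by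
    intro x y w
    have q1 := mul_nonneg hb (sq_nonneg (x - y))
    have q2 := mul_nonneg hb (sq_nonneg (y - w))
    have q1' := mul_nonneg hb (sq_nonneg (x + y))
    have q2' := mul_nonneg hb (sq_nonneg (y + w))
    have q3 := mul_nonneg (sub_nonneg.2 hb1) (sq_nonneg x)
    have q4 := mul_nonneg (sub_nonneg.2 hb1) (sq_nonneg y)
    have q5 := mul_nonneg (sub_nonneg.2 hb1) (sq_nonneg w)
    have s1 := sq_nonneg x
    have s2 := sq_nonneg y
    have s3 := sq_nonneg w
    constructor <;> linarith
  have h1 := aux (z 0).re (z 1).re (z 2).re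
  have h2 := aux (z 0).im (z 1).im (z 2).im
  simp only [← Complex.normSq_eq_norm_sq, Complex.normSq_apply]
  simp [Fin.sum_univ_three, lyapCoeff]
  constructor <;> linarith [h1.1, h1.2, h2.1, h2.2]

theorem le_exp_mul_of_deriv_le {y y' : ℝ → ℝ} {K : ℝ} (hc : ContinuousOn y (Set.Ici 0))
    (hd : ∀ t, 0 < t → HasDerivAt y (y' t) t) (hy : ∀ t, 0 < t → y' t ≤ -K * y t) {t : ℝ}
    (ht : 0 ≤ t) : y t ≤ Real.exp (-K * t) * y 0 := by
  have hanti : AntitoneOn (fun τ => Real.exp (K * τ) * y τ) (Set.Ici 0) := by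
    refine antitoneOn_of_hasDerivWithinAt_nonpos (convex_Ici 0)
      (f' := fun τ => Real.exp (K * τ) * K * y τ + Real.exp (K * τ) * y' τ)
      (ContinuousOn.mul (by fun_prop) hc) (fun τ hτ => ?_) (fun τ hτ => ?_)
    · rw [interior_Ici] at hτ
      have h1 : HasDerivAt (fun τ => Real.exp (K * τ)) (Real.exp (K * τ) * K) τ := by
        simpa using ((hasDerivAt_id τ).const_mul K).exp
      exact (h1.mul (hd τ hτ)).hasDerivWithinAt
    · rw [interior_Ici] at hτ
      have := hy τ hτ
      have he := Real.exp_pos (K * τ)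
      nlinarith
  have h := hanti (Set.mem_Ici.2 le_rfl) (Set.mem_Ici.2 ht) ht
  simp only [mul_zero, Real.exp_zero, one_mul] at h
  have he : Real.exp (-K * t) * Real.exp (K * t) = 1 := by rw [← Real.exp_add]; simp
  calc y t = Real.exp (-K * t) * (Real.exp (K * t) * y t) := by rw [← mul_assoc, he, one_mul]
    _ ≤ _ := by gcongr

/-! ### Decay of the weak solution at almost every frequency. -/

section System

variable {V : Type*} [NormedAddCommGroup V] [InnerProductSpace ℝ V] [FiniteDimensional ℝ V]
  [MeasurableSpace V] [BorelSpace V]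

theorem memLp_top_indicator_ball {f : V → ℝ} (hf : Continuous f) (R : ℝ) :
    MemLp ((Metric.ball (0 : V) R).indicator fun x => (f x : ℂ)) ∞ := by
  obtain ⟨C, hC⟩ := (isCompact_closedBall (0 : V) R).exists_bound_of_continuousOn hf.continuousOn
  refine memLp_top_of_bound (C := |C|) ?_ (Filter.Eventually.of_forall fun x => ?_)
  · exact (Complex.continuous_ofReal.comp hf).aestronglyMeasurable.indicator measurableSet_ball
  · by_cases hx : x ∈ Metric.ball (0 : V) R
    · rw [Set.indicator_of_mem hx, Complex.norm_real]
      exact (hC x (Metric.ball_subset_closedBall hx)).trans (le_abs_self C)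
    · rw [Set.indicator_of_notMem hx]; simp

/-- `Z` solves the plate system on the Fourier side, tested against Schwartz functions. -/
def IsWeakFourierSolution (a d : V → ℝ) (Z : Fin 3 → ℝ → Lp ℂ 2 (volume : Measure V)) : Prop :=
  (∀ i, ContinuousOn (Z i) (Set.Ici 0)) ∧
    ∀ i (ψ : 𝓢(V, ℂ)) (t : ℝ), 0 < t → HasDerivAt (fun τ => ∫ x, ψ x * Z i τ x)
      (∫ x, ψ x * plateField (a x) (d x) (fun j => Z j t x) i) t

/-- Cutting off to a ball makes the symbols bounded, so the vector field becomes continuous in time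
with values in L² and the weak-to-strong lemma applies. -/
theorem IsWeakFourierSolution.exists_hasDerivAt {a d : V → ℝ}
    {Z : Fin 3 → ℝ → Lp ℂ 2 (volume : Measure V)} (hZ : IsWeakFourierSolution a d Z)
    (ha : Continuous a) (hd : Continuous d) (R : ℝ)
    (hχ : MemLp ((Metric.ball (0 : V) R).indicator fun _ => (1 : ℂ)) ∞) {t : ℝ} (ht : 0 < t) :
    ∃ X' : Fin 3 → Lp ℂ 2 (volume : Measure V),
      (∀ i, HasDerivAt (fun τ => mulOp hχ (Z i τ)) (X' i) t) ∧
      ∀ᵐ x, x ∈ Metric.ball (0 : V) R →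
        ∀ i, X' i x = plateField (a x) (d x) (fun j => Z j t x) i := by
  have hA := memLp_top_indicator_ball ha R
  have hD := memLp_top_indicator_ball hd R
  set N : Fin 3 → ℝ → Lp ℂ 2 (volume : Measure V) := ![fun τ => mulOp hA (Z 1 τ),
    fun τ => -(mulOp hA (Z 0 τ)) + mulOp hA (Z 2 τ) - mulOp hD (Z 1 τ),
    fun τ => -(mulOp hA (Z 2 τ)) - mulOp hA (Z 1 τ)] with hN
  have hNc : ∀ i, ContinuousOn (N i) (Set.Ici 0) := by
    have hA' : ∀ i, ContinuousOn (fun τ => mulOp hA (Z i τ)) (Set.Ici 0) := fun i =>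
      (mulOp hA).continuous.comp_continuousOn (hZ.1 i)
    have hD' : ∀ i, ContinuousOn (fun τ => mulOp hD (Z i τ)) (Set.Ici 0) := fun i =>
      (mulOp hD).continuous.comp_continuousOn (hZ.1 i)
    intro i
    fin_cases i
    · exact hA' 1
    · exact ((hA' 0).neg.add (hA' 2)).sub (hD' 1)
    · exact (hA' 2).neg.sub (hA' 1)
  have hNe : ∀ i τ, ∀ᵐ x, x ∈ Metric.ball (0 : V) R →
      N i τ x = plateField (a x) (d x) (fun j => Z j τ x) i := by
    intro i τ
    have hA' : ∀ i, ∀ᵐ x, x ∈ Metric.ball (0 : V) R → mulOp hA (Z i τ) x = a x * Z i τ x :=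
      fun i => by
        filter_upwards [coeFn_mulOp hA (Z i τ)] with x hx hxR
        rw [hx, Set.indicator_of_mem hxR]
    have hD' : ∀ i, ∀ᵐ x, x ∈ Metric.ball (0 : V) R → mulOp hD (Z i τ) x = d x * Z i τ x :=
      fun i => by
        filter_upwards [coeFn_mulOp hD (Z i τ)] with x hx hxR
        rw [hx, Set.indicator_of_mem hxR]
    fin_cases i
    · exact hA' 1
    · filter_upwards [hA' 0, hA' 2, hD' 1, Lp.coeFn_sub (-(mulOp hA (Z 0 τ)) + mulOp hA (Z 2 τ))
        (mulOp hD (Z 1 τ)), Lp.coeFn_add (-(mulOp hA (Z 0 τ))) (mulOp hA (Z 2 τ)),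
        Lp.coeFn_neg (mulOp hA (Z 0 τ))] with x h1 h2 h3 h4 h5 h6 hx
      show (-(mulOp hA (Z 0 τ)) + mulOp hA (Z 2 τ) - mulOp hD (Z 1 τ) :
        Lp ℂ 2 (volume : Measure V)) x = _
      rw [h4, Pi.sub_apply, h5, Pi.add_apply, h6, Pi.neg_apply, h1 hx, h2 hx, h3 hx]
      rfl
    · filter_upwards [hA' 2, hA' 1, Lp.coeFn_sub (-(mulOp hA (Z 2 τ))) (mulOp hA (Z 1 τ)),
        Lp.coeFn_neg (mulOp hA (Z 2 τ))] with x h1 h2 h4 h6 hx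
      show (-(mulOp hA (Z 2 τ)) - mulOp hA (Z 1 τ) : Lp ℂ 2 (volume : Measure V)) x = _
      rw [h4, Pi.sub_apply, h6, Pi.neg_apply, h1 hx, h2 hx]
      rfl
  refine ⟨fun i => mulOp hχ (N i t), fun i => ?_, ?_⟩
  · refine hasDerivAt_mulOp_of_weak Metric.isOpen_ball hχ (hZ.1 i) (hNc i)
      (fun ψ hψ1 hψ2 hψ3 r hr => ?_) ht
    have hc : HasCompactSupport (Complex.ofRealCLM ∘ ψ) := hψ2.comp_left rfl
    have hs : ContDiff ℝ (⊤ : ℕ∞) (Complex.ofRealCLM ∘ ψ) := by fun_prop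
    have h := hZ.2 i (hc.toSchwartzMap hs) r hr
    convert! h using 1
    refine integral_congr_ae ?_
    filter_upwards [hNe i r] with x hx
    by_cases hxR : x ∈ Metric.ball (0 : V) R
    · rw [hx hxR]; rfl
    · have : ψ x = 0 := image_eq_zero_of_notMem_tsupport fun hxs => hxR (hψ3 hxs)
      simp [this]
  · have h1 : ∀ᵐ x, ∀ i, mulOp hχ (N i t) x =
        (Metric.ball (0 : V) R).indicator (fun _ => (1 : ℂ)) x * N i t x :=
      ae_all_iff.2 fun i => coeFn_mulOp hχ _
    have h2 := ae_all_iff.2 fun i => hNe i t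
    filter_upwards [h1, h2] with x h1 h2 hx i
    rw [h1 i, Set.indicator_of_mem hx, one_mul, h2 i hx]

/-- Each Z(t) is only an L² class, so there is no trajectory to differentiate at a fixed frequency.
The Lyapunov form integrated over A is a genuine differentiable function of time, and the lower
bound ρ₀ on A gives it a uniform rate. -/
theorem IsWeakFourierSolution.setIntegral_lyap_le {a d b : V → ℝ}
    {Z : Fin 3 → ℝ → Lp ℂ 2 (volume : Measure V)} (hZ : IsWeakFourierSolution a d Z)
    (ha : Continuous a) (hd : Continuous d) (hb : Measurable b) (ha0 : ∀ x, 0 ≤ a x)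
    (hd0 : ∀ x, 0 ≤ d x) (hb0 : ∀ x, 0 ≤ b x) (hb1 : ∀ x, b x ≤ 1) (hbd : ∀ x, b x * d x ≤ a x)
    {A : Set V} (hA : MeasurableSet A) {R ρ₀ : ℝ} (hAR : A ⊆ Metric.ball 0 R)
    (hAρ : ∀ x ∈ A, ρ₀ ≤ a x * b x) {t : ℝ} (ht : 0 ≤ t) :
    ∫ x in A, ∑ i, ∑ j, lyapCoeff (b x) i j * (starRingEnd ℂ (Z i t x) * Z j t x).re ≤
      Real.exp (-(ρ₀ / 256) * t) *
        ∫ x in A, ∑ i, ∑ j, lyapCoeff (b x) i j * (starRingEnd ℂ (Z i 0 x) * Z j 0 x).re := by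
  have hχ := memLp_top_indicator_ball (continuous_const (y := (1 : ℝ)) (X := V)) R
  simp only [Complex.ofReal_one] at hχ
  set m : Fin 3 → Fin 3 → V → ℝ := fun i j => A.indicator fun x => lyapCoeff (b x) i j with hm'
  have hm : ∀ i j, MemLp (fun x => (m i j x : ℂ)) ∞ := by
    intro i j
    have hmeas : Measurable fun x => lyapCoeff (b x) i j := by
      fin_cases i <;> fin_cases j <;> simp [lyapCoeff] <;> fun_prop
    refine memLp_top_of_bound (C := 1)
      (Complex.measurable_ofReal.comp (hmeas.indicator hA)).aestronglyMeasurable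
      (Filter.Eventually.of_forall fun x => ?_)
    rw [Complex.norm_real, Real.norm_eq_abs]
    by_cases hx : x ∈ A
    · simp only [hm', Set.indicator_of_mem hx]
      have h0 := hb0 x
      have h1 := hb1 x
      rw [abs_le]
      fin_cases i <;> fin_cases j <;> simp [lyapCoeff] <;> constructor <;> linarith
    · simp [hm', hx]
  set X : Fin 3 → ℝ → Lp ℂ 2 (volume : Measure V) := fun i τ => mulOp hχ (Z i τ) with hX
  have hXZ : ∀ τ, ∀ᵐ x, x ∈ A → ∀ i, X i τ x = Z i τ x := fun τ => by
    filter_upwards [ae_all_iff.2 fun i => coeFn_mulOp hχ (Z i τ)] with x h hx i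
    rw [hX, h i, Set.indicator_of_mem (hAR hx), one_mul]
  have hind : ∀ (x : V) (F G : Fin 3 → V → ℂ),
      ∑ i, ∑ j, m i j x * (starRingEnd ℂ (F i x) * G j x).re =
      A.indicator (fun x => ∑ i, ∑ j, lyapCoeff (b x) i j *
        (starRingEnd ℂ (F i x) * G j x).re) x := fun x F G => by
    by_cases hx : x ∈ A
    · simp only [hm', Set.indicator_of_mem hx]
    · simp only [hm', Set.indicator_of_notMem hx, zero_mul, Finset.sum_const_zero]
  set y : ℝ → ℝ := fun τ => ∫ x, ∑ i, ∑ j, m i j x * (starRingEnd ℂ (X i τ x) * X j τ x).re with hy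
  have hyA : ∀ τ, y τ = ∫ x in A, ∑ i, ∑ j, lyapCoeff (b x) i j *
      (starRingEnd ℂ (Z i τ x) * Z j τ x).re := fun τ => by
    rw [hy, ← integral_indicator hA]
    refine integral_congr_ae ?_
    filter_upwards [hXZ τ] with x hx
    rw [hind x (fun i => X i τ) (fun i => X i τ)]
    by_cases hxA : x ∈ A
    · simp only [Set.indicator_of_mem hxA, hx hxA]
    · simp only [Set.indicator_of_notMem hxA]
  have hder : ∀ τ, 0 < τ → ∃ y', HasDerivAt y y' τ ∧ y' ≤ -(ρ₀ / 256) * y τ := by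
    intro τ hτ
    obtain ⟨X', hX', hX'e⟩ := hZ.exists_hasDerivAt ha hd R hχ hτ
    refine ⟨_, hasDerivAt_integral_quadForm hm hX', ?_⟩
    rw [hy, ← integral_const_mul]
    refine integral_mono_ae
      ((integrable_quadForm hm (fun i => X i τ) X').add (integrable_quadForm hm X' (fun i => X i τ)))
      ((integrable_quadForm hm (fun i => X i τ) (fun i => X i τ)).const_mul _) ?_
    filter_upwards [hXZ τ, hX'e] with x h1 h2
    change (∑ i, ∑ j, m i j x * (starRingEnd ℂ (X i τ x) * X' j x).re) +
      (∑ i, ∑ j, m i j x * (starRingEnd ℂ (X' i x) * X j τ x).re) ≤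
      -(ρ₀ / 256) * ∑ i, ∑ j, m i j x * (starRingEnd ℂ (X i τ x) * X j τ x).re
    rw [hind x (fun i => X i τ) (fun i => X' i), hind x (fun i => X' i) (fun i => X i τ),
      hind x (fun i => X i τ) (fun i => X i τ)]
    by_cases hx : x ∈ A
    · simp only [Set.indicator_of_mem hx, h1 hx, h2 (hAR hx)]
      refine (lyap_decay (fun i => Z i τ x) (ha0 x) (hb0 x) (hb1 x) (hd0 x) (hbd x)).trans ?_
      have hl := (lyap_bounds (fun i => Z i τ x) (hb0 x) (hb1 x)).1
      have hnn : 0 ≤ 1 / 2 * ∑ i, ‖Z i τ x‖ ^ 2 := by positivity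
      exact mul_le_mul_of_nonneg_right (by linarith [hAρ x hx]) (hnn.trans hl)
    · simp [Set.indicator_of_notMem hx]
  choose! y' hy' hy'' using hder
  have := le_exp_mul_of_deriv_le (continuousOn_integral_quadForm hm fun i =>
    (mulOp hχ).continuous.comp_continuousOn (hZ.1 i)) hy' hy'' ht
  rw [← hyA t, ← hyA 0]
  exact this

theorem IsWeakFourierSolution.ae_bound {a d b : V → ℝ}
    {Z : Fin 3 → ℝ → Lp ℂ 2 (volume : Measure V)} (hZ : IsWeakFourierSolution a d Z)
    (ha : Continuous a) (hd : Continuous d) (hb : Measurable b) (ha0 : ∀ x, 0 ≤ a x)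
    (hd0 : ∀ x, 0 ≤ d x) (hb0 : ∀ x, 0 ≤ b x) (hb1 : ∀ x, b x ≤ 1) (hbd : ∀ x, b x * d x ≤ a x)
    {t : ℝ} (ht : 0 ≤ t) :
    ∀ᵐ x, ∑ i, ‖Z i t x‖ ^ 2 ≤
      4 * Real.exp (-(a x * b x / 512) * t) * ∑ i, ‖Z i 0 x‖ ^ 2 := by
  set L : ℝ → V → ℝ := fun τ x =>
    ∑ i, ∑ j, lyapCoeff (b x) i j * (starRingEnd ℂ (Z i τ x) * Z j τ x).re with hL
  have hLi : ∀ τ, Integrable (L τ) := fun τ => by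
    refine integrable_quadForm (m := fun i j x => lyapCoeff (b x) i j) (fun i j => ?_)
      (fun i => Z i τ) (fun i => Z i τ)
    have hmeas : Measurable fun x => lyapCoeff (b x) i j := by
      fin_cases i <;> fin_cases j <;> simp [lyapCoeff] <;> fun_prop
    refine memLp_top_of_bound (C := 1)
      (Complex.measurable_ofReal.comp hmeas).aestronglyMeasurable
      (Filter.Eventually.of_forall fun x => ?_)
    rw [Complex.norm_real, Real.norm_eq_abs, abs_le]
    have h0 := hb0 x
    have h1 := hb1 x
    fin_cases i <;> fin_cases j <;> simp [lyapCoeff] <;> constructor <;> linarith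
  -- Rational rates and integer radii keep the exceptional null sets countable in number. A rational
  -- in [ab/2, ab] is chosen afterwards, which turns 256 into 512.
  have key : ∀ (ρ₀ : ℚ) (R : ℕ), ∀ᵐ x, x ∈ Metric.ball (0 : V) R → (ρ₀ : ℝ) ≤ a x * b x →
      L t x ≤ Real.exp (-((ρ₀ : ℝ) / 256) * t) * L 0 x := by
    intro ρ₀ R
    set A : Set V := Metric.ball (0 : V) R ∩ {x | (ρ₀ : ℝ) ≤ a x * b x} with hA'
    have hA : MeasurableSet A := measurableSet_ball.inter
      (measurableSet_le measurable_const (ha.measurable.mul hb))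
    have h : L t ≤ᵐ[volume.restrict A] fun x => Real.exp (-((ρ₀ : ℝ) / 256) * t) * L 0 x := by
      refine ae_le_of_forall_setIntegral_le (hLi t).integrableOn
        ((hLi 0).const_mul _).integrableOn fun s hs _ => ?_
      rw [Measure.restrict_restrict hs, integral_const_mul]
      exact hZ.setIntegral_lyap_le ha hd hb ha0 hd0 hb0 hb1 hbd (hs.inter hA)
        (fun x hx => hx.2.1) (fun x hx => hx.2.2) ht
    filter_upwards [(ae_restrict_iff' hA).1 h] with x hx h1 h2 using hx ⟨h1, h2⟩
  filter_upwards [ae_all_iff.2 fun ρ₀ => ae_all_iff.2 (key ρ₀)] with x hx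
  obtain ⟨R, hR⟩ := exists_nat_gt ‖x‖
  have hρ : 0 ≤ a x * b x := mul_nonneg (ha0 x) (hb0 x)
  obtain ⟨ρ₀, h1, h2⟩ : ∃ ρ₀ : ℚ, a x * b x / 2 ≤ ρ₀ ∧ (ρ₀ : ℝ) ≤ a x * b x := by
    rcases hρ.eq_or_lt with h0 | h0
    · exact ⟨0, by rw [← h0]; simp, by rw [← h0]; simp⟩
    · obtain ⟨q, hq1, hq2⟩ := exists_rat_btwn (half_lt_self h0)
      exact ⟨q, hq1.le, hq2.le⟩
  have h3 := hx ρ₀ R (by simpa using hR) h2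
  have h4 := (lyap_bounds (fun i => Z i t x) (hb0 x) (hb1 x)).1
  have h5 := (lyap_bounds (fun i => Z i 0 x) (hb0 x) (hb1 x)).2
  have h6 : Real.exp (-((ρ₀ : ℝ) / 256) * t) ≤ Real.exp (-(a x * b x / 512) * t) := by
    rw [Real.exp_le_exp]
    nlinarith
  have h7 : 0 ≤ ∑ i, ‖Z i 0 x‖ ^ 2 := by positivity
  have h8 : L t x ≤ Real.exp (-(a x * b x / 512) * t) * (2 * ∑ i, ‖Z i 0 x‖ ^ 2) := by
    refine h3.trans ((mul_le_mul_of_nonneg_left h5 (Real.exp_pos _).le).trans ?_)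
    exact mul_le_mul_of_nonneg_right h6 (by positivity)
  have h9 : 1 / 2 * ∑ i, ‖Z i t x‖ ^ 2 ≤ L t x := h4
  linarith

end System

/-! ### Fourier transforms of L² functions, distributions and Schwartz functions. -/

section FourierSide

variable {V : Type*} [NormedAddCommGroup V] [InnerProductSpace ℝ V] [FiniteDimensional ℝ V]
  [MeasurableSpace V] [BorelSpace V]

theorem toTemperedDistribution_apply_eq_integral_fourier (F : Lp ℂ 2 (volume : Measure V))
    (φ : 𝓢(V, ℂ)) :
    (F : 𝓢'(V, ℂ)) φ = ∫ ξ, 𝓕⁻ φ ξ * (𝓕 F : Lp ℂ 2 (volume : Measure V)) ξ := by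
  have h : (F : 𝓢'(V, ℂ)) φ = (𝓕 (F : 𝓢'(V, ℂ))) (𝓕⁻ φ) := by
    rw [TemperedDistribution.fourier_apply, FourierTransform.fourier_fourierInv_eq]
  rw [h, Lp.fourier_toTemperedDistribution_eq, Lp.toTemperedDistribution_apply]
  simp only [smul_eq_mul]

theorem fourierInv_laplacian_apply (φ : 𝓢(V, ℂ)) (ξ : V) :
    𝓕⁻ (Δ φ) ξ = -(((2 * Real.pi * ‖ξ‖) ^ 2 : ℝ) : ℂ) * 𝓕⁻ φ ξ := by
  have h : ∀ (f : 𝓢(V, ℂ)) (x : V), 𝓕⁻ f x = 𝓕 f (-x) := fun f x => by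
    simp [SchwartzMap.fourier_coe, SchwartzMap.fourierInv_coe, Real.fourierInv_eq_fourier_neg]
  have hg : Function.HasTemperateGrowth fun x : V => ‖x‖ ^ 2 :=
    Function.hasTemperateGrowth_norm_sq V
  rw [h, h, SchwartzMap.laplacian_eq_fourierMultiplierCLM]
  rw [FourierTransform.fourier_smul, SchwartzMap.fourierMultiplierCLM_apply,
    FourierTransform.fourier_fourierInv_eq, smul_apply]
  erw [SchwartzMap.smulLeftCLM_apply_apply hg]
  simp
  ring

theorem norm_fourierInv_le (h : V → ℂ) (x : V) : ‖𝓕⁻ h x‖ ≤ ∫ ξ, ‖h ξ‖ := by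
  rw [Real.fourierInv_eq]
  refine (norm_integral_le_integral_norm _).trans (le_of_eq ?_)
  simp

/-- Identifies the integral inverse transform, which supplies a sup bound, with the Plancherel one,
which supplies square integrability; both have the same pairings with test functions. -/
theorem fourierInv_ae_eq_of_integrable {h : V → ℂ} (h1 : Integrable h) (h2 : MemLp h 2) :
    𝓕⁻ h =ᵐ[volume] (𝓕⁻ h2.toLp : Lp ℂ 2 (volume : Measure V)) := by
  have hc : Continuous (𝓕⁻ h) := by
    have : 𝓕⁻ h = fun x => 𝓕 h (-x) := funext fun x => Real.fourierInv_eq_fourier_neg h x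
    rw [this]
    exact (VectorFourier.fourierIntegral_continuous Real.continuous_fourierChar
      (L := innerₗ V) continuous_inner h1).comp continuous_neg
  refine ae_eq_of_integral_contDiff_smul_eq hc.locallyIntegrable
    ((Lp.memLp _).locallyIntegrable (by norm_num)) fun ψ hψ1 hψ2 => ?_
  have hsc : HasCompactSupport (Complex.ofRealCLM ∘ ψ) := hψ2.comp_left rfl
  have hs : ContDiff ℝ (⊤ : ℕ∞) (Complex.ofRealCLM ∘ ψ) := by fun_prop
  set φ : 𝓢(V, ℂ) := hsc.toSchwartzMap hs with hφ
  have e : ∀ x, φ x = (ψ x : ℂ) := fun x => rfl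
  have l : ∫ x, ψ x • 𝓕⁻ h x = ∫ x, h x * 𝓕⁻ φ x := by
    rw [SchwartzMap.fourierInv_coe, ← integral_fourierInv_mul_flip h1 φ.integrable]
    refine integral_congr_ae (Filter.Eventually.of_forall fun x => ?_)
    simp [e, mul_comm]
  have r : ∫ x, ψ x • (𝓕⁻ h2.toLp : Lp ℂ 2 (volume : Measure V)) x =
      ((𝓕⁻ h2.toLp : Lp ℂ 2 (volume : Measure V)) : 𝓢'(V, ℂ)) φ := by
    rw [Lp.toTemperedDistribution_apply]
    rfl
  rw [l, r, ← Lp.fourierInv_toTemperedDistribution_eq, TemperedDistribution.fourierInv_apply,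
    Lp.toTemperedDistribution_apply]
  refine integral_congr_ae ?_
  filter_upwards [h2.coeFn_toLp] with x hx
  rw [hx, smul_eq_mul, mul_comm]

theorem memLp_of_memLp_two_of_bound {g : V → ℂ} (hg : MemLp g 2) {C : ℝ} (hC : ∀ x, ‖g x‖ ≤ C)
    {q : ℝ≥0∞} (hq : 2 ≤ q) : MemLp g q := by
  rcases eq_or_ne q ∞ with rfl | hqt
  · exact memLp_top_of_bound hg.1 C (Filter.Eventually.of_forall hC)
  have hq0 : q ≠ 0 := (zero_lt_two.trans_le hq).ne'
  have hQ : 2 ≤ q.toReal := by simpa using ENNReal.toReal_mono hqt hq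
  have hC0 : 0 ≤ C := (norm_nonneg _).trans (hC 0)
  refine (integrable_norm_rpow_iff hg.1 hq0 hqt).1 ?_
  have h2 := (memLp_two_iff_integrable_sq_norm hg.1).1 hg
  refine (h2.const_mul (C ^ (q.toReal - 2))).mono'
    (hg.1.norm.aemeasurable.pow_const _).aestronglyMeasurable
    (Filter.Eventually.of_forall fun x => ?_)
  rw [Real.norm_of_nonneg (by positivity)]
  rcases (norm_nonneg (g x)).eq_or_lt with h0 | h0
  · rw [← h0, Real.zero_rpow (by linarith)]; positivity
  · have : ‖g x‖ ^ q.toReal = ‖g x‖ ^ (q.toReal - 2) * ‖g x‖ ^ 2 := by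
      rw [← Real.rpow_two, ← Real.rpow_add h0]; congr 1; ring
    rw [this]
    exact mul_le_mul_of_nonneg_right
      (Real.rpow_le_rpow (norm_nonneg _) (hC x) (by linarith)) (by positivity)

end FourierSide

/-! ### Bessel symbols, the plate system on the Fourier side, and the Riesz norm bound. -/

theorem hasTemperateGrowth_besselSymbol {n : ℕ} (M : ℝ) :
    Function.HasTemperateGrowth (besselSymbol M : EuclideanSpace ℝ (Fin n) → ℂ) := by
  have h1 := Function.hasTemperateGrowth_one_add_norm_sq_rpow (EuclideanSpace ℝ (Fin n)) (M / 2)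
  have h2 : Function.HasTemperateGrowth fun ξ : EuclideanSpace ℝ (Fin n) => (2 * Real.pi) • ξ :=
    ((2 * Real.pi) • ContinuousLinearMap.id ℝ (EuclideanSpace ℝ (Fin n))).hasTemperateGrowth
  exact Function.Complex.hasTemperateGrowth_ofReal.comp (h1.comp h2)

theorem norm_besselSymbol {n : ℕ} (M : ℝ) (ξ : EuclideanSpace ℝ (Fin n)) :
    ‖besselSymbol M ξ‖ = (1 + (2 * Real.pi * ‖ξ‖) ^ 2) ^ (M / 2) := by
  unfold besselSymbol
  rw [Complex.norm_real, Real.norm_of_nonneg (by positivity), norm_smul,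
    Real.norm_of_nonneg (by positivity)]

theorem norm_fourier_bessel {n : ℕ} (M : ℝ) (f : 𝓢(EuclideanSpace ℝ (Fin n), ℂ))
    (ξ : EuclideanSpace ℝ (Fin n)) :
    ‖𝓕 (SchwartzMap.fourierMultiplierCLM ℂ (besselSymbol M) f) ξ‖ =
      (1 + (2 * Real.pi * ‖ξ‖) ^ 2) ^ (M / 2) * ‖𝓕 f ξ‖ := by
  rw [SchwartzMap.fourierMultiplierCLM_apply, FourierTransform.fourier_fourierInv_eq,
    SchwartzMap.smulLeftCLM_apply_apply (hasTemperateGrowth_besselSymbol M), norm_smul,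
    norm_besselSymbol]

theorem memLp_mul_schwartz {n : ℕ} {m : EuclideanSpace ℝ (Fin n) → ℂ} (hm : Measurable m) {M : ℝ}
    (hle : ∀ ξ, ‖m ξ‖ ≤ (1 + (2 * Real.pi * ‖ξ‖) ^ 2) ^ (M / 2))
    (ψ : 𝓢(EuclideanSpace ℝ (Fin n), ℂ)) (p : ℝ≥0∞) : MemLp (fun ξ => m ξ * ψ ξ) p := by
  refine ((SchwartzMap.smulLeftCLM ℂ (besselSymbol M) ψ).memLp p volume).mono
    (hm.mul ψ.continuous.measurable).aestronglyMeasurable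
    (Filter.Eventually.of_forall fun ξ => ?_)
  rw [SchwartzMap.smulLeftCLM_apply_apply (hasTemperateGrowth_besselSymbol M), norm_smul, norm_mul,
    norm_besselSymbol]
  exact mul_le_mul_of_nonneg_right (hle ξ) (norm_nonneg _)

theorem rpow_le_one_add_sq_rpow {r s : ℝ} (hr : 0 ≤ r) (hs : 0 ≤ s) :
    r ^ s ≤ (1 + r ^ 2) ^ (s / 2) := by
  have : r ^ s = (r ^ 2) ^ (s / 2) := by
    rw [← Real.rpow_natCast, ← Real.rpow_mul hr]; congr 1; push_cast; ring
  rw [this]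
  exact Real.rpow_le_rpow (by positivity) (by linarith) (by positivity)

theorem memLp_rpow_mul_schwartz {n : ℕ} {s : ℝ} (hs : 0 ≤ s)
    (ψ : 𝓢(EuclideanSpace ℝ (Fin n), ℂ)) (p : ℝ≥0∞) :
    MemLp (fun ξ => (((2 * Real.pi * ‖ξ‖) ^ s : ℝ) : ℂ) * ψ ξ) p := by
  refine memLp_mul_schwartz (M := s) (by fun_prop) (fun ξ => ?_) ψ p
  rw [Complex.norm_real, Real.norm_of_nonneg (by positivity)]
  exact rpow_le_one_add_sq_rpow (by positivity) hs

theorem integrable_schwartz_mul_rpow_mul {n : ℕ} {s : ℝ} (hs : 0 ≤ s)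
    (ψ : 𝓢(EuclideanSpace ℝ (Fin n), ℂ)) (F : Lp ℂ 2 (volume : Measure (EuclideanSpace ℝ (Fin n)))) :
    Integrable fun ξ => ψ ξ * ((((2 * Real.pi * ‖ξ‖) ^ s : ℝ) : ℂ) * F ξ) := by
  have := (memLp_rpow_mul_schwartz hs ψ 2).integrable_mul (Lp.memLp F)
  refine this.congr (Filter.Eventually.of_forall fun ξ => ?_)
  simp only [Pi.mul_apply]; ring

theorem IsPlateSolution.isWeakFourierSolution {n : ℕ} {σ : ℝ}
    {u₀ : 𝓢'(EuclideanSpace ℝ (Fin n), ℂ)} {u₁ θ₀ : 𝓢(EuclideanSpace ℝ (Fin n), ℂ)}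
    {u : ℝ → 𝓢'(EuclideanSpace ℝ (Fin n), ℂ)}
    {v w θ : ℝ → Lp ℂ 2 (volume : Measure (EuclideanSpace ℝ (Fin n)))}
    (h : IsPlateSolution σ u₀ u₁ θ₀ u v w θ) (hσ : 0 ≤ σ) :
    IsWeakFourierSolution (fun ξ => (2 * Real.pi * ‖ξ‖) ^ 2)
      (fun ξ => (2 * Real.pi * ‖ξ‖) ^ (2 * σ))
      ![fun t => 𝓕 (v t), fun t => 𝓕 (w t), fun t => 𝓕 (θ t)] := by
  have hpair := fun F => toTemperedDistribution_apply_eq_integral_fourier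
    (V := EuclideanSpace ℝ (Fin n)) F
  have hψφ : ∀ ψ : 𝓢(EuclideanSpace ℝ (Fin n), ℂ), 𝓕⁻ (𝓕 ψ) = ψ := fun ψ =>
    FourierTransform.fourierInv_fourier_eq ψ
  have hΔ : ∀ (F : Lp ℂ 2 (volume : Measure (EuclideanSpace ℝ (Fin n))))
      (ψ : 𝓢(EuclideanSpace ℝ (Fin n), ℂ)),
      (F : 𝓢'(EuclideanSpace ℝ (Fin n), ℂ)) (Δ (𝓕 ψ)) =
        -∫ ξ, ψ ξ * ((((2 * Real.pi * ‖ξ‖) ^ 2 : ℝ) : ℂ) *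
          (𝓕 F : Lp ℂ 2 (volume : Measure (EuclideanSpace ℝ (Fin n)))) ξ) := fun F ψ => by
    rw [hpair, ← integral_neg]
    refine integral_congr_ae (Filter.Eventually.of_forall fun ξ => ?_)
    simp only
    rw [fourierInv_laplacian_apply, hψφ]
    ring
  have hint : ∀ (F : Lp ℂ 2 (volume : Measure (EuclideanSpace ℝ (Fin n))))
      (ψ : 𝓢(EuclideanSpace ℝ (Fin n), ℂ)),
      Integrable fun ξ => ψ ξ * ((((2 * Real.pi * ‖ξ‖) ^ 2 : ℝ) : ℂ) * F ξ) := fun F ψ => by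
    have := integrable_schwartz_mul_rpow_mul (s := 2) (by norm_num) ψ F
    simpa only [Real.rpow_two] using this
  refine ⟨fun i => ?_, fun i ψ t ht => ?_⟩
  · have hF := (FourierTransform.continuous_fourier (E := Lp ℂ 2
      (volume : Measure (EuclideanSpace ℝ (Fin n)))))
    fin_cases i
    · exact hF.comp_continuousOn h.continuousOn_v
    · exact hF.comp_continuousOn h.continuousOn_w
    · exact hF.comp_continuousOn h.continuousOn_θ
  · have hp' : ∀ F : Lp ℂ 2 (volume : Measure (EuclideanSpace ℝ (Fin n))),
        ∫ ξ, ψ ξ * (𝓕 F : Lp ℂ 2 (volume : Measure (EuclideanSpace ℝ (Fin n)))) ξ =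
        (F : 𝓢'(EuclideanSpace ℝ (Fin n), ℂ)) (𝓕 ψ) := fun F => by rw [hpair, hψφ]
    fin_cases i
    -- The equation for |D|²u comes from u_t alone, with the Laplacian moved to the test function.
    -- Testing with 𝓕ψ makes ψ itself the test function on the Fourier side.
    · have h1 := ((h.time_deriv t ht.le (Δ (𝓕 ψ))).hasDerivAt (Ici_mem_nhds ht)).neg
      rw [hΔ, neg_neg] at h1
      refine h1.congr_of_eventuallyEq ?_
      filter_upwards [lt_mem_nhds ht] with τ hτ
      show ∫ ξ, ψ ξ * (𝓕 (v τ) : Lp ℂ 2 (volume : Measure (EuclideanSpace ℝ (Fin n)))) ξ = _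
      rw [hp', ← h.absD_sq τ hτ.le]
      simp
    · have h1 := h.plate_eq t ht (𝓕 ψ)
      have e1 : (Δ (Δ (u t))) (𝓕 ψ) = -((v t : 𝓢'(EuclideanSpace ℝ (Fin n), ℂ)) (Δ (𝓕 ψ))) := by
        rw [← h.absD_sq t ht.le]
        simp
      have e2 : absDPairing (2 * σ) (w t) (𝓕 ψ) = ∫ ξ, ψ ξ *
          ((((2 * Real.pi * ‖ξ‖) ^ (2 * σ) : ℝ) : ℂ) *
          (𝓕 (w t) : Lp ℂ 2 (volume : Measure (EuclideanSpace ℝ (Fin n)))) ξ) := by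
        unfold absDPairing
        rw [hψφ]
        refine integral_congr_ae (Filter.Eventually.of_forall fun ξ => ?_)
        simp only; ring
      rw [e1, e2, TemperedDistribution.laplacian_apply_apply, hΔ, hΔ] at h1
      simp_rw [← hp'] at h1
      convert! h1 using 1
      have i1 := hint (𝓕 (v t)) ψ
      have i2 := hint (𝓕 (θ t)) ψ
      have i3 := integrable_schwartz_mul_rpow_mul (s := 2 * σ) (by linarith) ψ (𝓕 (w t))
      have i12 := i1.sub i2
      simp only [Pi.sub_def] at i12
      rw [neg_neg, ← sub_eq_add_neg, ← integral_sub i1 i2, ← integral_add i12 i3, ← integral_neg]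
      refine integral_congr_ae (Filter.Eventually.of_forall fun ξ => ?_)
      simp [plateField]
      ring
    · have h1 := h.heat_eq t ht (𝓕 ψ)
      rw [TemperedDistribution.laplacian_apply_apply, TemperedDistribution.laplacian_apply_apply,
        hΔ, hΔ] at h1
      simp_rw [← hp'] at h1
      convert! h1 using 1
      rw [← neg_add, ← integral_add (hint _ ψ) (hint _ ψ), ← integral_neg]
      refine integral_congr_ae (Filter.Eventually.of_forall fun ξ => ?_)
      simp [plateField]
      ring

/-- The representative of |D|^s F is the inverse transform g of h = r^s 𝓕F. Since m ≤ 1, h is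
dominated by weighted Schwartz functions, so g is bounded and in L², hence in L^q for q ≥ 2. This a
priori membership is what duality needs; the quantitative bound comes from `hbil` applied to ⟨D⟩^M
f_j. -/
theorem rieszNorm_le_of_fourier_bound {n : ℕ} {s M B : ℝ} (hs : 0 ≤ s) (hB : 0 ≤ B)
    {m : EuclideanSpace ℝ (Fin n) → ℝ} (hm : Measurable m) (hm0 : ∀ ξ, 0 ≤ m ξ)
    (hm1 : ∀ ξ, m ξ ≤ 1) {p q q' : ℝ≥0∞} [q'.HolderConjugate q] (hq : 2 ≤ q)
    {f : Fin 3 → 𝓢(EuclideanSpace ℝ (Fin n), ℂ)}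
    {F : Lp ℂ 2 (volume : Measure (EuclideanSpace ℝ (Fin n)))}
    (hF : ∀ᵐ ξ, ‖(𝓕 F : Lp ℂ 2 (volume : Measure (EuclideanSpace ℝ (Fin n)))) ξ‖ ≤
      2 * m ξ * ∑ j, ‖𝓕 (f j) ξ‖)
    (hbil : ∀ G φ : 𝓢(EuclideanSpace ℝ (Fin n), ℂ),
      ∫⁻ ξ, ENNReal.ofReal ((2 * Real.pi * ‖ξ‖) ^ s * m ξ *
        (1 + (2 * Real.pi * ‖ξ‖) ^ 2) ^ (-(M / 2))) * ‖𝓕 G ξ‖ₑ * ‖𝓕⁻ φ ξ‖ₑ ≤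
      ENNReal.ofReal B * (eLpNorm G p volume * eLpNorm φ q' volume)) :
    rieszNorm s q F ≤ ENNReal.ofReal (2 * B) * ∑ j, besselNorm M p (f j) := by
  set h : EuclideanSpace ℝ (Fin n) → ℂ := fun ξ => (((2 * Real.pi * ‖ξ‖) ^ s : ℝ) : ℂ) *
    (𝓕 F : Lp ℂ 2 (volume : Measure (EuclideanSpace ℝ (Fin n)))) ξ with hh
  have hhn : ∀ ξ, ‖h ξ‖ = (2 * Real.pi * ‖ξ‖) ^ s *
      ‖(𝓕 F : Lp ℂ 2 (volume : Measure (EuclideanSpace ℝ (Fin n)))) ξ‖ := fun ξ => by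
    rw [hh, norm_mul, Complex.norm_real, Real.norm_of_nonneg (by positivity)]
  have hhm : AEStronglyMeasurable h volume := by
    refine AEStronglyMeasurable.mul ?_ (Lp.aestronglyMeasurable _)
    exact Measurable.aestronglyMeasurable (by fun_prop)
  have hhp : ∀ r : ℝ≥0∞, MemLp h r := fun r => by
    have hdom : MemLp (fun ξ => ∑ j, (2 : ℝ) *
        ‖(((2 * Real.pi * ‖ξ‖) ^ s : ℝ) : ℂ) * 𝓕 (f j) ξ‖) r volume :=
      memLp_finsetSum _ fun j _ => (memLp_rpow_mul_schwartz hs (𝓕 (f j)) r).norm.const_mul 2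
    refine hdom.mono hhm ?_
    filter_upwards [hF] with ξ hξ
    rw [hhn, Real.norm_of_nonneg (by positivity), ← Finset.mul_sum]
    simp_rw [norm_mul, Complex.norm_real]
    rw [Real.norm_of_nonneg (by positivity), ← Finset.mul_sum]
    have : 2 * m ξ * ∑ j, ‖𝓕 (f j) ξ‖ ≤ 2 * ∑ j, ‖𝓕 (f j) ξ‖ := by
      have h1 := hm1 ξ
      have : 0 ≤ ∑ j, ‖𝓕 (f j) ξ‖ := by positivity
      nlinarith
    calc _ ≤ (2 * Real.pi * ‖ξ‖) ^ s * (2 * ∑ j, ‖𝓕 (f j) ξ‖) := by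
          gcongr; exact hξ.trans this
      _ = _ := by ring
  have hh1 : Integrable h := memLp_one_iff_integrable.1 (hhp 1)
  set g := 𝓕⁻ h with hg
  have hg2 : MemLp g 2 := (memLp_congr_ae (fourierInv_ae_eq_of_integrable hh1 (hhp 2))).2 (Lp.memLp _)
  have hgq : MemLp g q := memLp_of_memLp_two_of_bound hg2 (norm_fourierInv_le h) hq
  have hpair : ∀ φ : 𝓢(EuclideanSpace ℝ (Fin n), ℂ), ∫ x, φ x * g x = ∫ ξ, h ξ * 𝓕⁻ φ ξ := fun φ => by
    rw [SchwartzMap.fourierInv_coe, ← integral_fourierInv_mul_flip hh1 φ.integrable]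
    simp_rw [mul_comm (φ _)]
    rfl
  have hS : ∑ j, besselNorm M p (f j) ≠ ∞ := by
    rw [Ne, ENNReal.sum_eq_top]
    rintro ⟨j, _, hj⟩
    exact (SchwartzMap.memLp _ p volume).2.ne hj
  have hbound : ∀ φ : 𝓢(EuclideanSpace ℝ (Fin n), ℂ), ‖∫ x, φ x * g x‖ₑ ≤
      ENNReal.ofReal (2 * B * (∑ j, besselNorm M p (f j)).toReal) * eLpNorm φ q' volume := by
    intro φ
    rw [hpair, ENNReal.ofReal_mul (by positivity), ENNReal.ofReal_toReal hS]
    refine (enorm_integral_le_lintegral_enorm _).trans ?_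
    set G : Fin 3 → 𝓢(EuclideanSpace ℝ (Fin n), ℂ) := fun j =>
      SchwartzMap.fourierMultiplierCLM ℂ (besselSymbol M) (f j) with hG
    have hmG : ∀ H : 𝓢(EuclideanSpace ℝ (Fin n), ℂ), Measurable H := fun H => H.continuous.measurable
    have htwo : ∀ x : ℝ, 2 * ENNReal.ofReal x = ENNReal.ofReal (2 * x) := fun x => by
      rw [ENNReal.ofReal_mul (by norm_num), ENNReal.ofReal_ofNat]
    calc ∫⁻ ξ, ‖h ξ * 𝓕⁻ φ ξ‖ₑ ≤ ∫⁻ ξ, 2 * ∑ j, ENNReal.ofReal ((2 * Real.pi * ‖ξ‖) ^ s * m ξ *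
          (1 + (2 * Real.pi * ‖ξ‖) ^ 2) ^ (-(M / 2))) * ‖𝓕 (G j) ξ‖ₑ * ‖𝓕⁻ φ ξ‖ₑ := by
          refine lintegral_mono_ae ?_
          filter_upwards [hF] with ξ hξ
          have hmξ := hm0 ξ
          rw [← Finset.sum_mul, ← Finset.mul_sum, enorm_mul, ← mul_assoc]
          refine mul_le_mul_left ?_ _
          have e : ∀ j, ‖𝓕 (G j) ξ‖ₑ =
              ENNReal.ofReal ((1 + (2 * Real.pi * ‖ξ‖) ^ 2) ^ (M / 2) * ‖𝓕 (f j) ξ‖) := fun j => by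
            rw [← norm_fourier_bessel, ofReal_norm]
          simp_rw [e]
          rw [← ENNReal.ofReal_sum_of_nonneg (fun j _ => by positivity), ← ofReal_norm (h ξ), hhn,
            ← ENNReal.ofReal_mul (by positivity), htwo]
          refine ENNReal.ofReal_le_ofReal ?_
          rw [← Finset.mul_sum]
          have hone : (1 + (2 * Real.pi * ‖ξ‖) ^ 2) ^ (-(M / 2)) *
              (1 + (2 * Real.pi * ‖ξ‖) ^ 2) ^ (M / 2) = 1 := by
            rw [← Real.rpow_add (by positivity)]; simp
          calc _ ≤ (2 * Real.pi * ‖ξ‖) ^ s * (2 * m ξ * ∑ j, ‖𝓕 (f j) ξ‖) := by gcongr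
            _ = 2 * ((2 * Real.pi * ‖ξ‖) ^ s * m ξ * ((1 + (2 * Real.pi * ‖ξ‖) ^ 2) ^ (-(M / 2)) *
              (1 + (2 * Real.pi * ‖ξ‖) ^ 2) ^ (M / 2)) * ∑ j, ‖𝓕 (f j) ξ‖) := by rw [hone]; ring
            _ = _ := by ring
      _ = 2 * ∑ j, ∫⁻ ξ, ENNReal.ofReal ((2 * Real.pi * ‖ξ‖) ^ s * m ξ *
          (1 + (2 * Real.pi * ‖ξ‖) ^ 2) ^ (-(M / 2))) * ‖𝓕 (G j) ξ‖ₑ * ‖𝓕⁻ φ ξ‖ₑ := by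
          have m1 := hmG (𝓕⁻ φ)
          have m2 := fun j => hmG (𝓕 (G j))
          rw [lintegral_const_mul' _ _ (by simp), lintegral_finsetSum _ fun j _ => ?_]
          have := m2 j
          fun_prop
      _ ≤ 2 * ∑ j, ENNReal.ofReal B * (eLpNorm (G j) p volume * eLpNorm φ q' volume) := by
          gcongr with j _
          exact hbil (G j) φ
      _ = _ := by
          rw [← Finset.mul_sum, ← Finset.sum_mul, ENNReal.ofReal_mul (by norm_num)]
          simp only [ENNReal.ofReal_ofNat, besselNorm, hG]
          ring
  have hnorm := eLpNorm_le_of_schwartz_pairing hq hgq (by positivity) hbound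
  rw [ENNReal.ofReal_mul (by positivity), ENNReal.ofReal_toReal hS] at hnorm
  refine le_trans (iInf₂_le g ⟨hgq, fun φ => ?_⟩) hnorm
  rw [hpair]
  rfl

/-! ### The decay rate as a function of frequency, and the main estimate. -/

/-- The ratio of the cross terms to the squares in the Lyapunov form at the frequency `r`. -/
noncomputable def crossWeight (σ r : ℝ) : ℝ := min 1 (r ^ 2 / r ^ (2 * σ))

theorem crossWeight_nonneg {r : ℝ} (hr : 0 ≤ r) (σ : ℝ) : 0 ≤ crossWeight σ r :=
  le_min zero_le_one (by positivity)

theorem crossWeight_mul_le {r : ℝ} (hr : 0 ≤ r) (σ : ℝ) :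
    crossWeight σ r * r ^ (2 * σ) ≤ r ^ 2 := by
  rcases (Real.rpow_nonneg hr (2 * σ)).eq_or_lt with h | h
  · rw [← h, mul_zero]; positivity
  · exact (le_div_iff₀ h).1 (min_le_right _ _)

theorem sq_mul_crossWeight {r : ℝ} (hr : 0 < r) (σ : ℝ) :
    r ^ 2 * crossWeight σ r = min (r ^ (2 : ℝ)) (r ^ (4 - 2 * σ)) := by
  unfold crossWeight
  rw [mul_min_of_nonneg _ _ (by positivity), mul_one, Real.rpow_two]
  congr 1
  rw [Real.rpow_sub hr, mul_div_assoc', ← pow_add]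
  norm_cast

theorem rpow_le_sq_mul_crossWeight {σ k r : ℝ} (hk : 2 ≤ k) (hkσ : 4 - 2 * σ ≤ k) (hr : 0 ≤ r)
    (hr1 : r ≤ 1) : r ^ k ≤ r ^ 2 * crossWeight σ r := by
  rcases hr.eq_or_lt with h | h
  · rw [← h, Real.zero_rpow (by linarith)]; simp
  · rw [sq_mul_crossWeight h]
    exact le_min (Real.rpow_le_rpow_of_exponent_ge h hr1 hk)
      (Real.rpow_le_rpow_of_exponent_ge h hr1 hkσ)

theorem one_le_sq_mul_crossWeight {σ r : ℝ} (hσ : σ ≤ 2) (hr : 1 ≤ r) :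
    1 ≤ r ^ 2 * crossWeight σ r := by
  rw [sq_mul_crossWeight (by linarith)]
  exact le_min (Real.one_le_rpow hr (by norm_num)) (Real.one_le_rpow hr (by linarith))

theorem IsPlateSolution.ae_fourier_bound {n : ℕ} {σ : ℝ}
    {u₀ : 𝓢'(EuclideanSpace ℝ (Fin n), ℂ)} {v₀ u₁ θ₀ : 𝓢(EuclideanSpace ℝ (Fin n), ℂ)}
    (hu₀ : -(Δ u₀) = (v₀ : 𝓢'(EuclideanSpace ℝ (Fin n), ℂ)))
    {u : ℝ → 𝓢'(EuclideanSpace ℝ (Fin n), ℂ)}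
    {v w θ : ℝ → Lp ℂ 2 (volume : Measure (EuclideanSpace ℝ (Fin n)))}
    (h : IsPlateSolution σ u₀ u₁ θ₀ u v w θ) (hσ : 0 ≤ σ) {t : ℝ} (ht : 0 ≤ t) (i : Fin 3) :
    ∀ᵐ ξ, ‖(𝓕 (![v t, w t, θ t] i) : Lp ℂ 2 (volume : Measure (EuclideanSpace ℝ (Fin n)))) ξ‖ ≤
      2 * Real.exp (-(1 / 1024 * ((2 * Real.pi * ‖ξ‖) ^ 2 *
        crossWeight σ (2 * Real.pi * ‖ξ‖)) * t)) * ∑ j, ‖𝓕 (![v₀, u₁, θ₀] j) ξ‖ := by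
  -- An L² function is determined by its distribution, so the initial value of |D|²u is the given
  -- Schwartz function.
  have hv : v 0 = v₀.toLp 2 volume := by
    have h0 := h.absD_sq 0 le_rfl
    rw [h.init_u, hu₀] at h0
    have hker := Lp.ker_toTemperedDistributionCLM_eq_bot (F := ℂ)
      (μ := (volume : Measure (EuclideanSpace ℝ (Fin n)))) (p := 2)
    refine LinearMap.ker_eq_bot.1 hker ?_
    show (v 0 : 𝓢'(EuclideanSpace ℝ (Fin n), ℂ)) =
      ((v₀.toLp 2 volume : Lp ℂ 2 (volume : Measure (EuclideanSpace ℝ (Fin n)))) :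
        𝓢'(EuclideanSpace ℝ (Fin n), ℂ))
    rw [Lp.toTemperedDistribution_toLp_eq]
    exact h0.symm
  have hb := (h.isWeakFourierSolution hσ).ae_bound (by fun_prop) (by
      have : 0 ≤ 2 * σ := by linarith
      fun_prop (disch := assumption))
    (b := fun ξ => crossWeight σ (2 * Real.pi * ‖ξ‖)) (by unfold crossWeight; fun_prop)
    (fun ξ => by positivity) (fun ξ => by positivity)
    (fun ξ => crossWeight_nonneg (by positivity) σ) (fun ξ => min_le_left _ _)
    (fun ξ => crossWeight_mul_le (by positivity) σ) ht
  have hinit : ∀ f : 𝓢(EuclideanSpace ℝ (Fin n), ℂ), ∀ᵐ ξ,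
      (𝓕 (f.toLp 2 volume) : Lp ℂ 2 (volume : Measure (EuclideanSpace ℝ (Fin n)))) ξ = 𝓕 f ξ :=
    fun f => by
      rw [SchwartzMap.toLp_fourier_eq]
      exact SchwartzMap.coeFn_toLp _ _ _
  filter_upwards [hb, hinit v₀, hinit u₁, hinit θ₀] with ξ h1 e0 e1 e2
  simp only [Fin.sum_univ_three, Matrix.cons_val_zero, Matrix.cons_val_one,
    Matrix.cons_val, hv, h.init_w, h.init_θ, e0, e1, e2] at h1 ⊢
  set E := Real.exp (-(1 / 1024 * ((2 * Real.pi * ‖ξ‖) ^ 2 *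
        crossWeight σ (2 * Real.pi * ‖ξ‖)) * t)) with hE
  -- The bound on squares has constant 4 and rate ab/512; the square root gives 2 and ab/1024.
  have hE2 : Real.exp (-((2 * Real.pi * ‖ξ‖) ^ 2 * crossWeight σ (2 * Real.pi * ‖ξ‖) / 512) * t) =
      E ^ 2 := by
    rw [hE, ← Real.exp_nat_mul]; congr 1; push_cast; ring
  rw [hE2] at h1
  have hE0 : 0 < E := Real.exp_pos _
  have hx := norm_nonneg (𝓕 v₀ ξ)
  have hy := norm_nonneg (𝓕 u₁ ξ)
  have hz := norm_nonneg (𝓕 θ₀ ξ)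
  have hsq : ‖𝓕 v₀ ξ‖ ^ 2 + ‖𝓕 u₁ ξ‖ ^ 2 + ‖𝓕 θ₀ ξ‖ ^ 2 ≤
      (‖𝓕 v₀ ξ‖ + ‖𝓕 u₁ ξ‖ + ‖𝓕 θ₀ ξ‖) ^ 2 := by
    nlinarith [mul_nonneg hx hy, mul_nonneg hx hz, mul_nonneg hy hz]
  refine le_of_sq_le_sq ?_ (by positivity)
  rw [mul_pow, mul_pow, show (2 : ℝ) ^ 2 = 4 by norm_num]
  refine le_trans ?_ (h1.trans (mul_le_mul_of_nonneg_left hsq (by positivity)))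
  fin_cases i
  · simp only [Fin.zero_eta, Matrix.cons_val_zero]
    nlinarith [sq_nonneg ‖(𝓕 (w t) : Lp ℂ 2 (volume : Measure (EuclideanSpace ℝ (Fin n)))) ξ‖,
      sq_nonneg ‖(𝓕 (θ t) : Lp ℂ 2 (volume : Measure (EuclideanSpace ℝ (Fin n)))) ξ‖]
  · simp only [Fin.mk_one, Matrix.cons_val_one, Matrix.cons_val_zero]
    nlinarith [sq_nonneg ‖(𝓕 (v t) : Lp ℂ 2 (volume : Measure (EuclideanSpace ℝ (Fin n)))) ξ‖,
      sq_nonneg ‖(𝓕 (θ t) : Lp ℂ 2 (volume : Measure (EuclideanSpace ℝ (Fin n)))) ξ‖]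
  · simp only [Fin.reduceFinMk, Matrix.cons_val]
    nlinarith [sq_nonneg ‖(𝓕 (v t) : Lp ℂ 2 (volume : Measure (EuclideanSpace ℝ (Fin n)))) ξ‖,
      sq_nonneg ‖(𝓕 (w t) : Lp ℂ 2 (volume : Measure (EuclideanSpace ℝ (Fin n)))) ξ‖]

theorem mainTheorem8 (n : ℕ) (hn : 1 ≤ n) (σ s M : ℝ) (p q : ℝ≥0∞)
    (hσ : σ ∈ Set.Ico (0 : ℝ) 1 ∪ Set.Ioc (1 : ℝ) 2) (hs : 0 ≤ s)
    (hp1 : 1 ≤ p) (hp2 : p ≤ 2) (hq : 2 ≤ q)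
    (hM : s + n * (p⁻¹.toReal - q⁻¹.toReal) < M) :
    ∃ C : ℝ, 0 < C ∧
      ∀ (u₀ : 𝓢'(EuclideanSpace ℝ (Fin n), ℂ)) (v₀ u₁ θ₀ : 𝓢(EuclideanSpace ℝ (Fin n), ℂ)),
        -(Δ u₀) = (v₀ : 𝓢'(EuclideanSpace ℝ (Fin n), ℂ)) →
        ∀ (u : ℝ → 𝓢'(EuclideanSpace ℝ (Fin n), ℂ))
          (v w θ : ℝ → Lp ℂ 2 (volume : Measure (EuclideanSpace ℝ (Fin n)))),
          IsPlateSolution σ u₀ u₁ θ₀ u v w θ →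
          ∀ t : ℝ, 0 ≤ t →
            rieszNorm s q (v t) + rieszNorm s q (w t) + rieszNorm s q (θ t) ≤
              ENNReal.ofReal (C * (1 + t) ^ (-decayRate σ n p q s)) *
                (besselNorm M p v₀ + besselNorm M p u₁ + besselNorm M p θ₀) := by
  have hσ0 : 0 ≤ σ := by rcases hσ with h | h <;> linarith [h.1]
  have hσ2 : σ ≤ 2 := by rcases hσ with h | h <;> linarith [h.2]
  -- k is the larger of 2 and 4 - 2σ, the exponent of the slower decay rate as r → 0.
  obtain ⟨k, hk, hkσ, hrate⟩ : ∃ k : ℝ, 2 ≤ k ∧ 4 - 2 * σ ≤ k ∧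
      decayRate σ n p q s = (s + n * (p⁻¹.toReal - q⁻¹.toReal)) / k := by
    unfold decayRate
    rcases hσ with h | h
    · exact ⟨4 - 2 * σ, by linarith [h.2], le_rfl, by rw [if_pos h.2]⟩
    · exact ⟨2, le_rfl, by linarith [h.1], by rw [if_neg (not_lt.2 h.1.le)]⟩
  have hqi : q⁻¹ ≤ 2⁻¹ := ENNReal.inv_le_inv.2 hq
  have hqi1 : q⁻¹ ≤ 1 := hqi.trans (by simp)
  set q' : ℝ≥0∞ := (1 - q⁻¹)⁻¹ with hq'
  have hconj : q.HolderConjugate q' :=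
    ENNReal.HolderConjugate.inv_one_sub_inv' (le_trans (by norm_num) hq)
  have hq'1 : 1 ≤ q' := ENNReal.HolderConjugate.one_le q' q
  have hq'2 : q' ≤ 2 := by
    rw [hq', ENNReal.inv_le_iff_inv_le]
    calc (2 : ℝ≥0∞)⁻¹ = 1 - 2⁻¹ := by rw [ENNReal.one_sub_inv_two]
      _ ≤ 1 - q⁻¹ := tsub_le_tsub_left hqi 1
  have hq'i : q'⁻¹.toReal = 1 - q⁻¹.toReal := by
    rw [hq', inv_inv, ENNReal.toReal_sub_of_le hqi1 (by simp)]; simp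
  -- The two losses relative to L² add up to n(1/p - 1/q), since 1/q' = 1 - 1/q; this includes q =
  -- ∞, q' = 1.
  have hexp : s + n * (p⁻¹.toReal - 1 / 2) + n * (q'⁻¹.toReal - 1 / 2) =
      s + n * (p⁻¹.toReal - q⁻¹.toReal) := by rw [hq'i]; ring
  obtain ⟨C, hC, hbil⟩ := exists_bilinear_multiplier_bound (V := EuclideanSpace ℝ (Fin n)) (M := M)
    (c := 1 / 1024) (ρ := fun r => r ^ 2 * crossWeight σ r) hs hk (by norm_num)
    (fun r h0 h1 => rpow_le_sq_mul_crossWeight hk hkσ h0 h1)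
    (fun r h1 => one_le_sq_mul_crossWeight hσ2 h1) hp1 hp2 hq'1 hq'2
    (by rw [finrank_euclideanSpace_fin, hexp]; exact hM)
  rw [finrank_euclideanSpace_fin, hexp, ← hrate] at hbil
  -- Three components, each bounded with constant 2C.
  refine ⟨6 * C, by positivity, fun u₀ v₀ u₁ θ₀ hu₀ u v w θ hsol t ht => ?_⟩
  have ht1 : 0 < 1 + t := by linarith
  have hone : ∀ i : Fin 3, rieszNorm s q (![v t, w t, θ t] i) ≤
      ENNReal.ofReal (2 * (C * (1 + t) ^ (-decayRate σ n p q s))) *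
        ∑ j, besselNorm M p (![v₀, u₁, θ₀] j) := fun i =>
    rieszNorm_le_of_fourier_bound hs (by positivity)
      (m := fun ξ => Real.exp (-(1 / 1024 * ((2 * Real.pi * ‖ξ‖) ^ 2 *
        crossWeight σ (2 * Real.pi * ‖ξ‖)) * t))) (by unfold crossWeight; fun_prop)
      (fun ξ => (Real.exp_pos _).le)
      (fun ξ => Real.exp_le_one_iff.2 (neg_nonpos.2 (by
        have := crossWeight_nonneg (by positivity : 0 ≤ 2 * Real.pi * ‖ξ‖) σ
        positivity))) hq (hsol.ae_fourier_bound hu₀ hσ0 ht i) (hbil t ht)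
  have h0 := hone 0
  have h1 := hone 1
  have h2 := hone 2
  simp only [Fin.sum_univ_three, Matrix.cons_val_zero, Matrix.cons_val_one,
    Matrix.cons_val] at h0 h1 h2
  refine (add_le_add (add_le_add h0 h1) h2).trans (le_of_eq ?_)
  rw [← add_mul, ← add_mul, ← ENNReal.ofReal_add (by positivity) (by positivity),
    ← ENNReal.ofReal_add (by positivity) (by positivity)]
  congr 2
  ring
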